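/- Fix $T\ge 1$, particle numbers $N_1,\dots,N_T\ge 1$, MCMC run lengths $C_1,\dots,C_{T-1}\ge 1$, a value of the model parameter (suppressed below) and observations $y_1,\dots,y_T$. Let $\mathcal X$ be a measurable space with a $\sigma$-finite reference measure $\mu$, written $dx$. Let $f_1(x)$, $f_t(x'|x)$ be strictly positive finite (transition) probability densities w.r.t. $\mu$, let $g_t(y_t|x)$ be strictly positive finite observation densities, and let $M_1(x|y_1)$, $M_t(x'|y_t,x)$ be strictly positive finite importance probability densities w.r.t. $\mu$, all measurable. Put $p(y_{1:T},x_{1:T})=g_1(y_1|x_1)f_1(x_1)\prod_{t=2}^T g_t(y_t|x_t)f_t(x_t|x_{t-1})$, assume $p(y_{1:T})=\int p(y_{1:T},x_{1:T})\,dx_{1:T}<\infty$, and let $\pi(x_{1:T})=p(y_{1:T},x_{1:T})/p(y_{1:T})$. Let $U=(\overline{\mathbf X}_{1:T},\overline{\mathbf A}_{1:T-1},\mathbf B_{1:T},\widetilde{\mathbf X}_{1:T-1})$ with particles $\overline{\mathbf X}_t=(X_t^i)_{i\le N_t}$, ancestor indices $\overline{\mathbf A}_{t}=(A_{t}^i)_{i\le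 N_{t+1}}$ in $\{1,\dots,N_t\}$, backward indices $B_t\in\{1,\dots,N_t\}$, and MCMC states $\widetilde{\mathbf X}_t=(\widetilde X_t^j)_{j\le C_t}$. A superscript $-b$ means that the component number $b$ is left out. Write $z_t=\widetilde x_t^{C_t}$ for $t<T$ and $z_T=x_T^{b_T}$ (the retained states). Define the weights $w_1^i=g_1(y_1|x_1^i)f_1(x_1^i)/M_1(x_1^i|y_1)$ and, with $k=a_{t-1}^i$, $w_t^i=g_t(y_t|x_t^i)f_t(x_t^i|x_{t-1}^{k})/M_t(x_t^i|y_t,x_{t-1}^{k})$ for $t\ge 2$; let $W_t^i=w_t^i/\sum_j w_t^j$. For $t<T$ let $K_t(x,dx'|\overline{\mathbf x}_{1:t-1},\mathbf x_t^{-b_t},z_{t+1},\overline{\mathbf a}_{1:t-2},\mathbf a_{t-1}^{-b_t})$ be a Markov kernel on $\mathcal X$, jointly measurable in $x$ and the conditioning variables (for instance an MCMC kernel), abbreviated $K_t(x,dx'|\cdot)$. Let $$\Psi(d\overline{\mathbf x}_{1:T},\overline{\mathbf a}_{1:T-1})=\prod_{i=1}^{N_1}M_1(dx_1^i|y_1)\prod_{t=2}^T\prod_{i=1}^{N_t}W_{t-1}^{a_{t-1}^i}M_t(dx_t^i|y_t,x_{t-1}^{a_{t-1}^i})$$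 be the law of the output of the sequential Monte Carlo algorithm with these importance densities, and define the target distribution (with $a_{t-1}^{b_t}$ the parent of particle $b_t$ at time $t$) $$\Pi(du)=\pi(z_{1:T})\,dz_{1:T}\,\frac1{N_T}\;\frac{\Psi(d\overline{\mathbf x}_{1:T},\overline{\mathbf a}_{1:T-1})}{M_1(dx_1^{b_1}|y_1)\prod_{t=2}^T W_{t-1}^{a_{t-1}^{b_t}}M_t(dx_t^{b_t}|y_t,x_{t-1}^{a_{t-1}^{b_t}})}\;\prod_{t=2}^T\frac{w_{t-1}^{a_{t-1}^{b_t}}f_t(x_t^{b_t}|x_{t-1}^{a_{t-1}^{b_t}})}{\sum_i w_{t-1}^i f_t(x_t^{b_t}|x_{t-1}^i)}\;\prod_{t=1}^{T-1}\Big\{\frac1{N_t}\prod_{j=2}^{C_t}K_t(\widetilde x_t^j,d\widetilde x_t^{j-1}|\cdot)\,K_t(\widetilde x_t^1,dx_t^{b_t}|\cdot)\Big\},$$ with counting measure for all indices. The particle Gibbs (conditional SMC) algorithm takes the retained variables $(\widetilde x_1^{C_1},\dots,\widetilde x_{T-1}^{C_{T-1}},x_T^{b_T},b_T)$ as input, leaves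 them unchanged, and generates the other components of $U$ as follows. (1) For $t=1,\dots,T-1$: draw $B_t$ uniformly on $\{1,\dots,N_t\}$; for each $i\ne B_t$ draw (if $t>1$) $A_{t-1}^i$ with probabilities $W_{t-1}$ and then $X_t^i\sim M_t(\cdot|y_t,X_{t-1}^{A_{t-1}^i})$ (for $t=1$: $X_1^i\sim M_1(\cdot|y_1)$); for $j=C_t-1,\dots,1$ draw $\widetilde X_t^j\sim K_t(\widetilde X_t^{j+1},\cdot\,|\cdot)$; draw $X_t^{B_t}\sim K_t(\widetilde X_t^1,\cdot\,|\cdot)$; if $t>1$, draw $A_{t-1}^{B_t}$ with probabilities proportional to $w_{t-1}^i f_t(X_t^{B_t}|X_{t-1}^i)$. (2) If $T>1$, draw $A_{T-1}^{B_T}$ with probabilities proportional to $w_{T-1}^i f_T(X_T^{B_T}|X_{T-1}^i)$. (3) For each $i\neq B_T$ draw (if $T>1$) $A_{T-1}^i$ with probabilities $W_{T-1}$ and then $X_T^i$ from the importance density. Then $\Pi$ is a probability measure, and the algorithm generates a sample from $$\Pi\big(d\overline{\mathbf x}_{1:T-1},d\mathbf x_T^{-b_T},\overline{\mathbf a}_{1:T-1},\mathbf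 b_{1:T-1},d\widetilde{\mathbf x}_1^{-C_1},\dots,d\widetilde{\mathbf x}_{T-1}^{-C_{T-1}}\,\big|\,\widetilde x_1^{C_1},\dots,\widetilde x_{T-1}^{C_{T-1}},x_T^{b_T},b_T\big).$$ That is, the law of the algorithm's output $U$, as a function of the retained variables, is a Markov kernel under which the retained variables keep their given values, and it is a regular version of the conditional distribution under $\Pi$ of $U$ given the retained variables. -/

import Mathlib

open MeasureTheory ProbabilityTheory
open scoped NNReal ENNReal

noncomputable section

namespace ParticleGibbs

/-!
Conventions. There are `T = n + 1` times, indexed by `t : Fin (n + 1)`; the time index `0` is the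
first time and `Fin.last n` is the final time `T`. An index `s : Fin n` stands either for the
non-final time `s.castSucc` or for the transition from time `s.castSucc` to time `s.succ`.
There are `N t` particles at time `t` and the MCMC run at the non-final time `s` has length `C s`.
The parameter of the model is fixed throughout and not displayed.
-/

/-- The sample space of `U = (X, A, B, X̃)`: particles `x t i`, ancestor indices `a s i` (the index,
among the particles at time `s.castSucc`, of the parent of particle `i` at time `s.succ`), backward
indices `b t`, and MCMC states `xt s j` (`j = 0, …, C s - 1` in place of `1, …, C s`). -/
abbrev Aug (X : Type*) {n : ℕ} (N : Fin (n + 1) → ℕ) (C : Fin n → ℕ) : Type _ :=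
  ((t : Fin (n + 1)) → Fin (N t) → X) ×
  ((s : Fin n) → Fin (N s.succ) → Fin (N s.castSucc)) ×
  ((t : Fin (n + 1)) → Fin (N t)) ×
  ((s : Fin n) → Fin (C s) → X)

/-- The retained variables: one state for every time, and the index at the final time. -/
abbrev Ret (X : Type*) {n : ℕ} (N : Fin (n + 1) → ℕ) : Type _ :=
  (Fin (n + 1) → X) × Fin (N (Fin.last n))

namespace Aug

variable {X : Type*} {n : ℕ} {N : Fin (n + 1) → ℕ} {C : Fin n → ℕ}

def x (u : Aug X N C) : (t : Fin (n + 1)) → Fin (N t) → X := u.1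

def a (u : Aug X N C) : (s : Fin n) → Fin (N s.succ) → Fin (N s.castSucc) := u.2.1

def b (u : Aug X N C) : (t : Fin (n + 1)) → Fin (N t) := u.2.2.1

def xt (u : Aug X N C) : (s : Fin n) → Fin (C s) → X := u.2.2.2

/-- Overwrite the particle `x t i`. -/
def setX (t : Fin (n + 1)) (i : Fin (N t)) (u : Aug X N C) (v : X) : Aug X N C :=
  (Function.update u.x t (Function.update (u.x t) i v), u.a, u.b, u.xt)

/-- Overwrite the ancestor index `a s i`. -/
def setA (s : Fin n) (i : Fin (N s.succ)) (u : Aug X N C) (k : Fin (N s.castSucc)) :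
    Aug X N C :=
  (u.x, Function.update u.a s (Function.update (u.a s) i k), u.b, u.xt)

/-- Overwrite the backward index `b t`. -/
def setB (t : Fin (n + 1)) (u : Aug X N C) (k : Fin (N t)) : Aug X N C :=
  (u.x, u.a, Function.update u.b t k, u.xt)

/-- Overwrite the MCMC state `xt s j`. -/
def setXt (s : Fin n) (j : Fin (C s)) (u : Aug X N C) (v : X) : Aug X N C :=
  (u.x, u.a, u.b, Function.update u.xt s (Function.update (u.xt s) j v))

/-- The retained state of every time: the last state `X̃ₜ^{Cₜ}` of the MCMC run for the non-final
times, and the particle `X_T^{B_T}` for the final time. -/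
def retState (hC : ∀ s, 0 < C s) (u : Aug X N C) : Fin (n + 1) → X :=
  Fin.snoc (fun s : Fin n => u.xt s ⟨C s - 1, Nat.sub_lt (hC s) Nat.one_pos⟩)
    (u.x (Fin.last n) (u.b (Fin.last n)))

/-- The retained part `(X̃₁^{C₁}, …, X̃_{T-1}^{C_{T-1}}, X_T^{B_T}, B_T)` of `U`. -/
def ret (hC : ∀ s, 0 < C s) (u : Aug X N C) : Ret X N :=
  (u.retState hC, u.b (Fin.last n))

/-- The initial memory of a program whose input is the retained variables: every state slot of time
`t` holds the retained state of time `t`, `b` at the final time holds the retained index, and all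
other indices are `0`. In particular the retained slots hold their values; every other slot is
overwritten before it is used. -/
def init (hN : ∀ t, 0 < N t) (r : Ret X N) : Aug X N C :=
  (fun t _ => r.1 t, fun s _ => ⟨0, hN s.castSucc⟩,
    Fin.snoc (α := fun t => Fin (N t)) (fun s : Fin n => ⟨0, hN s.castSucc⟩) r.2,
    fun s _ => r.1 s.castSucc)

/-- `u` and `v` agree on everything that the transition kernel `K_t`, `t = s.castSucc`, is
conditioned on: `b_t`, all particles and ancestor indices of the particles up to time `t` except
those of particle number `b_t` at time `t`, and the retained state of time `t + 1`. -/
def CondAgree (hC : ∀ s, 0 < C s) (s : Fin n) (u v : Aug X N C) : Prop :=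
  u.b s.castSucc = v.b s.castSucc ∧
  (∀ t : Fin (n + 1), t ≤ s.castSucc → ∀ i, (t = s.castSucc → i ≠ u.b t) → u.x t i = v.x t i) ∧
  (∀ r : Fin n, r.succ ≤ s.castSucc → ∀ i, (r.succ = s.castSucc → i ≠ u.b r.succ) →
    u.a r i = v.a r i) ∧
  u.retState hC s.succ = v.retState hC s.succ

end Aug

/-- A state space model with positive densities (with respect to `μ`) for the states, importance
densities, observations `y`, numbers of particles and MCMC steps, and backward MCMC kernels. -/
structure Model (X Y : Type*) [MeasurableSpace X] (μ : Measure X) (n : ℕ)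
    (N : Fin (n + 1) → ℕ) (C : Fin n → ℕ) where
  /-- numbers of particles are positive -/
  hN : ∀ t, 0 < N t
  /-- lengths of MCMC runs are positive -/
  hC : ∀ s, 0 < C s
  /-- the observations -/
  y : Fin (n + 1) → Y
  /-- initial density -/
  f₁ : X → ℝ≥0
  f₁_meas : Measurable f₁
  f₁_pos : ∀ x, 0 < f₁ x
  f₁_int : ∫⁻ x, f₁ x ∂μ = 1
  /-- `f s x x'` is the transition density at `x'` of the state at time `s.succ` given the
  state `x` at time `s.castSucc` -/
  f : Fin n → X → X → ℝ≥0
  f_meas : ∀ s, Measurable (Function.uncurry (f s))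
  f_pos : ∀ s x x', 0 < f s x x'
  f_int : ∀ s x, ∫⁻ x', f s x x' ∂μ = 1
  /-- `g t y x` is the observation density at `y` given the state `x` -/
  g : Fin (n + 1) → Y → X → ℝ≥0
  g_meas : ∀ t y, Measurable (g t y)
  g_pos : ∀ t y x, 0 < g t y x
  /-- `M₁ y x` is the importance density at `x` of the first time -/
  M₁ : Y → X → ℝ≥0
  M₁_meas : ∀ y, Measurable (M₁ y)
  M₁_pos : ∀ y x, 0 < M₁ y x
  M₁_int : ∀ y, ∫⁻ x, M₁ y x ∂μ = 1
  /-- `M s y x x'` is the importance density at `x'` of time `s.succ` given the state `x` -/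
  M : Fin n → Y → X → X → ℝ≥0
  M_meas : ∀ s y, Measurable (Function.uncurry (M s y))
  M_pos : ∀ s y x x', 0 < M s y x x'
  M_int : ∀ s y x, ∫⁻ x', M s y x x' ∂μ = 1
  /-- `K s (x, u)` is the law of the next MCMC state at time `s.castSucc` if the current one is
  `x`; it depends on `u` only through the variables listed in `CondAgree`. -/
  K : (s : Fin n) → Kernel (X × Aug X N C) X
  K_markov : ∀ s, IsMarkovKernel (K s)
  K_cond : ∀ s x (u v : Aug X N C), u.CondAgree hC s v → K s (x, u) = K s (x, v)

/-! ### Random assignments -/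

section Programs

variable {U V : Type*} [MeasurableSpace U] [MeasurableSpace V]

/-- "Draw `v` from `κ u` and write it into the memory `u`". -/
def assign (κ : Kernel U V) (write : U → V → U) : Kernel U U :=
  (Kernel.id ×ₖ κ).map (fun p => write p.1 p.2)

/-- Execute the steps of a list from left to right. -/
def run (l : List (Kernel U U)) : Kernel U U :=
  l.foldl (fun acc κ => κ ∘ₖ acc) Kernel.id

/-- The kernel whose value at `u` has the density `d u` with respect to `ρ`. -/
def drawDensity (ρ : Measure V) [SFinite ρ] (d : U → V → ℝ≥0) : Kernel U V :=
  (Kernel.const U ρ).withDensity (fun u v => (d u v : ℝ≥0∞))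

/-- The discrete distribution on `Fin m` with probability vector `p u`. -/
def drawIndex {m : ℕ} (p : U → Fin m → ℝ≥0) : Kernel U (Fin m) :=
  drawDensity Measure.count p

/-- Execute `κ` if the memory satisfies `P`, and do nothing otherwise. -/
def onlyIf (P : U → Prop) (hP : MeasurableSet {u | P u}) (κ : Kernel U U) : Kernel U U := by
  classical exact Kernel.piecewise hP κ Kernel.id

end Programs

/-- The event that particle `i` at time `t` is not the particle number `b t`. -/
theorem measurableSet_ne_b {X : Type*} [MeasurableSpace X] {n : ℕ} {N : Fin (n + 1) → ℕ}
    {C : Fin n → ℕ} (t : Fin (n + 1)) (i : Fin (N t)) :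
    MeasurableSet {u : Aug X N C | i ≠ u.b t} := by
  have h : Measurable (fun u : Aug X N C => u.b t) := by
    unfold Aug.b; fun_prop
  simpa [Set.preimage, eq_comm] using h (measurableSet_singleton i).compl

theorem measurable_xt {X : Type*} [MeasurableSpace X] {n : ℕ} {N : Fin (n + 1) → ℕ}
    {C : Fin n → ℕ} (s : Fin n) (j : Fin (C s)) :
    Measurable (fun u : Aug X N C => u.xt s j) := by
  unfold Aug.xt; fun_prop

theorem measurable_init {X : Type*} [MeasurableSpace X] {n : ℕ} {N : Fin (n + 1) → ℕ}
    {C : Fin n → ℕ} (hN : ∀ t, 0 < N t) :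
    Measurable (Aug.init hN : Ret X N → Aug X N C) := by
  have h : Measurable (fun k : Fin (N (Fin.last n)) =>
      (Fin.snoc (α := fun t => Fin (N t)) (fun s : Fin n => ⟨0, hN s.castSucc⟩) k :
        (t : Fin (n + 1)) → Fin (N t))) := measurable_of_countable _
  have h' := h.comp (measurable_snd : Measurable (Prod.snd : Ret X N → _))
  unfold Aug.init
  refine Measurable.prodMk (by fun_prop) (Measurable.prodMk (by fun_prop)
    (Measurable.prodMk h' (by fun_prop)))

namespace Model

variable {X Y : Type*} [MeasurableSpace X] {μ : Measure X} {n : ℕ}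
  {N : Fin (n + 1) → ℕ} {C : Fin n → ℕ} (m : Model X Y μ n N C)

/-! ### Weights -/

/-- Unnormalized particle weights `w_t^i`. -/
def w (u : Aug X N C) : (t : Fin (n + 1)) → Fin (N t) → ℝ≥0 :=
  Fin.cases
    (fun i => m.g 0 (m.y 0) (u.x 0 i) * m.f₁ (u.x 0 i) / m.M₁ (m.y 0) (u.x 0 i))
    (fun s i =>
      m.g s.succ (m.y s.succ) (u.x s.succ i) *
          m.f s (u.x s.castSucc (u.a s i)) (u.x s.succ i) /
        m.M s (m.y s.succ) (u.x s.castSucc (u.a s i)) (u.x s.succ i))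

/-- Normalized particle weights `W_t^i`. -/
def W (u : Aug X N C) (t : Fin (n + 1)) (i : Fin (N t)) : ℝ≥0 :=
  m.w u t i / ∑ j, m.w u t j

/-- Unnormalized ancestor weights `v^i` for the parent of particle number `b` at time `s.succ`. -/
def v (u : Aug X N C) (s : Fin n) (i : Fin (N s.castSucc)) : ℝ≥0 :=
  m.w u s.castSucc i * m.f s (u.x s.castSucc i) (u.x s.succ (u.b s.succ))

/-- Normalized ancestor weights. -/
def V (u : Aug X N C) (s : Fin n) (i : Fin (N s.castSucc)) : ℝ≥0 :=
  m.v u s i / ∑ j, m.v u s j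

/-! ### The MCMC run of one time, from its last state back to the particle `x t (b t)` -/

/-- Draw `xt s j'` from the kernel `K s` started at `xt s j`. -/
def drawMCMC (s : Fin n) (j j' : Fin (C s)) : Kernel (Aug X N C) (Aug X N C) :=
  assign ((m.K s).comap (fun u => (u.xt s j, u)) ((measurable_xt s j).prodMk measurable_id))
    (Aug.setXt s j')

/-- Draw `x t (b t)`, `t = s.castSucc`, from the kernel `K s` started at the first state `xt s 0`
of the MCMC run. -/
def drawFromMCMC (s : Fin n) : Kernel (Aug X N C) (Aug X N C) :=
  assign ((m.K s).comap (fun u => (u.xt s ⟨0, m.hC s⟩, u))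
      ((measurable_xt s ⟨0, m.hC s⟩).prodMk measurable_id))
    (fun u => Aug.setX s.castSucc (u.b s.castSucc) u)

/-- Starting at the retained state `X̃^C`, draw `X̃^{C-1}, …, X̃^1` and then `X^B`. -/
def backwardRun (s : Fin n) : List (Kernel (Aug X N C) (Aug X N C)) :=
  ((List.finRange (C s - 1)).reverse.map fun k : Fin (C s - 1) =>
    m.drawMCMC s ⟨(k : ℕ) + 1, by have := k.2; omega⟩ ⟨(k : ℕ), by have := k.2; omega⟩) ++
    [m.drawFromMCMC s]

/-! ### The particle Gibbs algorithm -/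

/-- Draw `b t` uniformly. -/
def drawB (t : Fin (n + 1)) : Kernel (Aug X N C) (Aug X N C) :=
  assign (drawIndex fun _ _ => 1 / (N t : ℝ≥0)) (Aug.setB t)

/-- Draw the parent of particle number `b t` at time `t` from the normalized ancestor weights
(nothing to be done at the first time). -/
def drawParent : Fin (n + 1) → List (Kernel (Aug X N C) (Aug X N C)) :=
  Fin.cases []
    (fun s => [assign (drawIndex fun u => m.V u s) (fun u => Aug.setA s (u.b s.succ) u)])

section Algorithm

variable [SigmaFinite μ]

/-- One particle of the sequential Monte Carlo algorithm: draw the parent of particle `i` at time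
`t` (if `t` is not the first time) from the normalized weights, then the particle from the
importance density. -/
def drawParticle : (t : Fin (n + 1)) → Fin (N t) → Kernel (Aug X N C) (Aug X N C) :=
  Fin.cases
    (fun i => assign (drawDensity μ fun _ x' => m.M₁ (m.y 0) x') (Aug.setX 0 i))
    (fun s i => run [
      assign (drawIndex fun u => m.W u s.castSucc) (Aug.setA s i),
      assign (drawDensity μ fun u x' => m.M s (m.y s.succ) (u.x s.castSucc (u.a s i)) x')
        (Aug.setX s.succ i)])

/-- The sequential Monte Carlo draws of all particles at time `t` other than number `b t`, together
with their parents. -/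
def drawOthers (t : Fin (n + 1)) : List (Kernel (Aug X N C) (Aug X N C)) :=
  (List.finRange (N t)).map fun i =>
    onlyIf (fun u => i ≠ u.b t) (measurableSet_ne_b t i) (m.drawParticle t i)

/-- The body of the loop over the non-final times. -/
def gibbsStep (s : Fin n) : List (Kernel (Aug X N C) (Aug X N C)) :=
  [drawB s.castSucc] ++ m.drawOthers s.castSucc ++ m.backwardRun s ++ m.drawParent s.castSucc

/-- The particle Gibbs (conditional sequential Monte Carlo) algorithm, as a program acting on the
memory. -/
def gibbsProgram : Kernel (Aug X N C) (Aug X N C) :=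
  run ((List.finRange n).flatMap m.gibbsStep ++ m.drawParent (Fin.last n) ++
    m.drawOthers (Fin.last n))

/-- The law of the output of the particle Gibbs algorithm, given the retained variables. -/
def gibbs : Kernel (Ret X N) (Aug X N C) :=
  m.gibbsProgram ∘ₖ Kernel.deterministic (Aug.init m.hN) (measurable_init m.hN)

end Algorithm

/-! ### The target distribution -/

/-- The joint density `p(y_{1:T}, x_{1:T})`. -/
def joint (z : Fin (n + 1) → X) : ℝ≥0 :=
  m.g 0 (m.y 0) (z 0) * m.f₁ (z 0) *
    ∏ s : Fin n, m.g s.succ (m.y s.succ) (z s.succ) * m.f s (z s.castSucc) (z s.succ)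

/-- The marginal density `p(y_{1:T})` of the observations. -/
def evidence : ℝ≥0∞ :=
  ∫⁻ z, (m.joint z : ℝ≥0∞) ∂(Measure.pi fun _ : Fin (n + 1) => μ)

/-- The posterior density `π(x_{1:T}) = p(x_{1:T} | y_{1:T})`. -/
def posterior (z : Fin (n + 1) → X) : ℝ≥0∞ :=
  (m.joint z : ℝ≥0∞) / m.evidence

/-- The density `Ψ(x, a)` of the particles and ancestor indices that are generated by the
sequential Monte Carlo algorithm. -/
def smcDensity (u : Aug X N C) : ℝ≥0 :=
  (∏ i, m.M₁ (m.y 0) (u.x 0 i)) *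
    ∏ s : Fin n, (∏ i, m.W u s.castSucc (u.a s i)) *
      ∏ i, m.M s (m.y s.succ) (u.x s.castSucc (u.a s i)) (u.x s.succ i)

/-- The factors of `smcDensity` that belong to the particles number `b t`. -/
def smcDensityB (u : Aug X N C) : ℝ≥0 :=
  m.M₁ (m.y 0) (u.x 0 (u.b 0)) *
    ∏ s : Fin n, m.W u s.castSucc (u.a s (u.b s.succ)) *
      m.M s (m.y s.succ) (u.x s.castSucc (u.a s (u.b s.succ))) (u.x s.succ (u.b s.succ))

/-- The factor
`∏_{t=2}^T w_{t-1}^{a} f_t(x_t^{b_t} | x_{t-1}^{a}) / ∑_i w_{t-1}^i f_t(x_t^{b_t} | x_{t-1}^i)`,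
where `a` is the parent of particle number `b_t` at time `t`. -/
def ancestorFactor (u : Aug X N C) : ℝ≥0 :=
  ∏ s : Fin n,
    (m.w u s.castSucc (u.a s (u.b s.succ)) *
        m.f s (u.x s.castSucc (u.a s (u.b s.succ))) (u.x s.succ (u.b s.succ))) /
      ∑ i, m.w u s.castSucc i * m.f s (u.x s.castSucc i) (u.x s.succ (u.b s.succ))

/-- The density part of the target distribution, i.e. everything except the factors `K_t`. -/
def targetDensity (u : Aug X N C) : ℝ≥0∞ :=
  m.posterior (u.retState m.hC) * (1 / (N (Fin.last n) : ℝ≥0) : ℝ≥0) *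
    (m.smcDensity u / m.smcDensityB u : ℝ≥0) * (m.ancestorFactor u : ℝ≥0∞) *
    ((∏ s : Fin n, 1 / (N s.castSucc : ℝ≥0) : ℝ≥0) : ℝ≥0∞)

section Target

variable [SigmaFinite μ]

/-- The product of counting measure for the index `b s.castSucc`, over the non-final times. -/
def baseB : List (Kernel (Aug X N C) (Aug X N C)) :=
  (List.finRange n).map fun s => assign (Kernel.const _ Measure.count) (Aug.setB s.castSucc)

/-- The product of counting measure for all ancestor indices. -/
def baseA : List (Kernel (Aug X N C) (Aug X N C)) :=
  (List.finRange n).flatMap fun s => (List.finRange (N s.succ)).map fun i =>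
    assign (Kernel.const _ Measure.count) (Aug.setA s i)

/-- The product of `μ` for all particles `x t i` with `i ≠ b t`. -/
def baseX (μ : Measure X) : List (Kernel (Aug X N C) (Aug X N C)) :=
  (List.finRange (n + 1)).flatMap fun t => (List.finRange (N t)).map fun i =>
    onlyIf (fun u => i ≠ u.b t) (measurableSet_ne_b t i)
      (assign (Kernel.const _ μ) (Aug.setX t i))

/-- The measure
`dx̃₁^{C₁} ⋯ dx̃_{T-1}^{C_{T-1}} dx_T^{b_T} ∏_t dx_t^{-b_t}
  ∏_{t<T} { ∏_{j=2}^{C_t} K_t(x̃_t^j, dx̃_t^{j-1} | ⋯) } K_t(x̃_t^1, dx_t^{b_t} | ⋯)`,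
with counting measure for all indices. The factor `K_t` is conditioned on variables of the earlier
times, so these factors are applied in the order of increasing `t`. -/
def base : Measure (Aug X N C) :=
  ((Measure.pi fun _ : Fin (n + 1) => μ).prod Measure.count).bind
    (run (baseB ++ baseA ++ baseX μ ++ (List.finRange n).flatMap m.backwardRun) ∘ₖ
      Kernel.deterministic (Aug.init m.hN) (measurable_init m.hN))

/-- The target distribution `Π` on the augmented space. -/
def target : Measure (Aug X N C) :=
  m.base.withDensity m.targetDensity

end Target

end Model

end ParticleGibbs

end

/-! The algorithm and the base measure of Π are both lists of random writes into one memory. A step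
acts on nonnegative measurable functions of the memory by integration, a density acts by
multiplication, and a program acts by the product of its steps in order of execution. In this
monoid, `Op`, the theorem rests on one identity, `base_mul_targetDensity`: (base program) · (density
of Π) = (density of the retained variables) · (algorithm). Evaluated at the initial memory and
integrated over the reference measure of the retained variables, it says that Π is the retained law
π(z)/N_T followed by the algorithm (`target_eq`). The retained law has mass one because the evidence
is neither 0 nor infinite. Multiplication by a function of the retained variables commutes with the
algorithm (`commute_ret_gibbsProgram`). This turns the composition into the disintegration
`target_map_ret` and shows that the retained values are kept (`gibbs_map_ret`).

The identity is a reordering of commuting factors. By `ofKernel_assign_drawDensity`, a draw from a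
density is integration against μ or counting measure followed by multiplication by the density. Two
steps commute if neither reads or overwrites what the other writes (`commute_assign_assign`, which
is Tonelli). A density therefore moves to the right past all later draws. The factor K_t moves past
the draws of later times and past the sum over the parent of particle b_t, because it is not
conditioned on those variables (`gibbsStep_fixed`, `gibbs_fixed`). The densities collected at the
end multiply to Ψ, divided by its factors for the particles b_t, times the ancestor factor
(`prod_timeDensity_eq`), and the uniform indices contribute ∏ 1/N_t. The kernels K_t appear on both
sides unchanged, so neither invariance nor reversibility of K_t plays a role.

The obstacle is that b_t decides which slot is written. The draws of the indices are therefore moved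
to the front (`ofKernel_gibbsProgram`). The remaining steps never change b, so on each set where
`u.b = b` they may be replaced by steps with the constant b (`AgreeOn`, `agreeOn_givenIndicesOp`),
and all commutations are proved for those. -/

noncomputable section

namespace ParticleGibbs

/-! ### Operators on nonnegative measurable functions -/

/-- Operators on the nonnegative measurable functions on `U`. The product is composition, so that
a program that executes its factors from left to right acts by their product. -/
abbrev Op (U : Type*) [MeasurableSpace U] : Type _ :=
  Function.End {F : U → ℝ≥0∞ // Measurable F}

namespace Op

variable {U V V' : Type*} [MeasurableSpace U] [MeasurableSpace V] [MeasurableSpace V']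

theorem mul_apply (S T : Op U) (F) : (S * T) F = S (T F) := rfl

/-- Integration with respect to a kernel. -/
def ofKernel (κ : Kernel U U) : Op U :=
  fun F => ⟨fun u => ∫⁻ v, F.1 v ∂κ u, F.2.lintegral_kernel⟩

/-- Multiplication by a function. -/
def scale (d : U → ℝ≥0∞) (hd : Measurable d) : Op U :=
  fun F => ⟨fun u => d u * F.1 u, hd.mul F.2⟩

theorem op_ext {S T : Op U} (h : ∀ F u, (S F).1 u = (T F).1 u) : S = T := by
  funext F
  exact Subtype.ext (funext (h F))

theorem ofKernel_apply (κ : Kernel U U) (F) (u : U) :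
    (ofKernel κ F).1 u = ∫⁻ v, F.1 v ∂κ u := rfl

theorem scale_apply (d : U → ℝ≥0∞) (hd : Measurable d) (F) (u : U) :
    (scale d hd F).1 u = d u * F.1 u := rfl

theorem ofKernel_id : ofKernel (Kernel.id : Kernel U U) = 1 :=
  op_ext fun F u => by
    rw [ofKernel_apply, Kernel.id_apply, lintegral_dirac' _ F.2]; rfl

theorem ofKernel_comp (κ η : Kernel U U) : ofKernel (η ∘ₖ κ) = ofKernel κ * ofKernel η :=
  op_ext fun F u => by
    rw [ofKernel_apply, Kernel.lintegral_comp _ _ _ F.2]; rfl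

theorem ofKernel_foldl (l : List (Kernel U U)) (κ : Kernel U U) :
    ofKernel (l.foldl (fun acc η => η ∘ₖ acc) κ) = ofKernel κ * (l.map ofKernel).prod := by
  induction l generalizing κ with
  | nil => simp
  | cons η l ih => rw [List.foldl_cons, ih, ofKernel_comp, List.map_cons, List.prod_cons, mul_assoc]

theorem ofKernel_run (l : List (Kernel U U)) : ofKernel (run l) = (l.map ofKernel).prod := by
  rw [run, ofKernel_foldl, ofKernel_id, one_mul]

theorem scale_one : scale (fun _ : U => 1) measurable_const = 1 :=
  op_ext fun F u => by rw [scale_apply, one_mul]; rfl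

theorem scale_congr {d d' : U → ℝ≥0∞} (hd : Measurable d) (hd' : Measurable d')
    (h : ∀ u, d u = d' u) : scale d hd = scale d' hd' :=
  op_ext fun F u => by rw [scale_apply, scale_apply, h]

theorem scale_mul_scale {d d' : U → ℝ≥0∞} (hd : Measurable d) (hd' : Measurable d') :
    scale d hd * scale d' hd' = scale (fun u => d u * d' u) (hd.mul hd') :=
  op_ext fun _ _ => (mul_assoc _ _ _).symm

theorem commute_scale_scale {d d' : U → ℝ≥0∞} (hd : Measurable d) (hd' : Measurable d') :
    Commute (scale d hd) (scale d' hd') :=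
  op_ext fun _ _ => mul_left_comm _ _ _

theorem measurable_list_prod_map {ι : Type*} (l : List ι) {d : ι → U → ℝ≥0∞}
    (hd : ∀ i, Measurable (d i)) : Measurable fun u => (l.map fun i => d i u).prod := by
  induction l with
  | nil => exact measurable_const
  | cons i l ih => exact (hd i).mul ih

theorem prod_scale {ι : Type*} (l : List ι) {d : ι → U → ℝ≥0∞} (hd : ∀ i, Measurable (d i)) :
    (l.map fun i => scale (d i) (hd i)).prod =
      scale (fun u => (l.map fun i => d i u).prod) (measurable_list_prod_map l hd) := by
  induction l with
  | nil => exact scale_one.symm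
  | cons i l ih =>
    rw [List.map_cons, List.prod_cons, ih, scale_mul_scale]
    rfl

/-- Multiplication by a finite density. -/
abbrev weight (d : U → ℝ≥0) (hd : Measurable d) : Op U :=
  scale (fun u => (d u : ℝ≥0∞)) hd.coe_nnreal_ennreal

theorem weight_one {d : U → ℝ≥0} (hd : Measurable d) (h : ∀ u, d u = 1) : weight d hd = 1 := by
  rw [weight, ← scale_one]
  exact scale_congr _ _ fun u => by rw [h, ENNReal.coe_one]

theorem weight_mul_weight {d d' : U → ℝ≥0} (hd : Measurable d)
    (hd' : Measurable d') :
    weight d hd * weight d' hd' = weight (fun u => d u * d' u) (hd.mul hd') := by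
  rw [weight, weight, scale_mul_scale]
  exact scale_congr _ _ fun u => (ENNReal.coe_mul _ _).symm

theorem prod_weight {m : ℕ} {d : Fin m → U → ℝ≥0} (hd : ∀ i, Measurable (d i)) :
    ((List.finRange m).map fun i => weight (d i) (hd i)).prod =
      weight (fun u => ∏ i, d i u) (Finset.measurable_fun_prod _ fun i _ => hd i) := by
  unfold weight
  rw [prod_scale _ fun i => (hd i).coe_nnreal_ennreal]
  exact scale_congr _ _ fun u => by rw [ENNReal.ofNNReal_finsetProd, Fin.prod_univ_def]

theorem commute_scale_const (c : ℝ≥0∞) (κ : Kernel U U) :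
    Commute (scale (fun _ => c) measurable_const) (ofKernel κ) :=
  op_ext fun F _ => (lintegral_const_mul c F.2).symm

/-! ### Random assignments -/

theorem lintegral_assign (κ : Kernel U V) [IsSFiniteKernel κ] {w : U → V → U}
    (hw : Measurable (Function.uncurry w)) {F : U → ℝ≥0∞} (hF : Measurable F) (u : U) :
    ∫⁻ u', F u' ∂assign κ w u = ∫⁻ v, F (w u v) ∂κ u := by
  have hw' : Measurable fun p : U × V => w p.1 p.2 := hw
  rw [assign, Kernel.lintegral_map _ hw' _ hF]
  exact Kernel.lintegral_id_prod (hF.comp hw') κ u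

theorem ofKernel_assign_apply (κ : Kernel U V) [IsSFiniteKernel κ] {w : U → V → U}
    (hw : Measurable (Function.uncurry w)) (F) (u : U) :
    (ofKernel (assign κ w) F).1 u = ∫⁻ v, F.1 (w u v) ∂κ u :=
  lintegral_assign κ hw F.2 u

/-- Tonelli: neither law sees the other write, and the two writes can be interchanged, so both
orders are the same double integral. -/
theorem commute_assign_assign (κ : Kernel U V) [IsSFiniteKernel κ] (κ' : Kernel U V')
    [IsSFiniteKernel κ'] {w : U → V → U} {w' : U → V' → U}
    (hw : Measurable (Function.uncurry w)) (hw' : Measurable (Function.uncurry w'))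
    (h : ∀ u v, κ (w' u v) = κ u) (h' : ∀ u v, κ' (w u v) = κ' u)
    (hc : ∀ u v v', w' (w u v) v' = w (w' u v') v) :
    Commute (ofKernel (assign κ w)) (ofKernel (assign κ' w')) :=
  op_ext fun F u => by
    rw [mul_apply, mul_apply, ofKernel_assign_apply _ hw, ofKernel_assign_apply _ hw']
    simp_rw [ofKernel_assign_apply _ hw, ofKernel_assign_apply _ hw', h, h', hc]
    refine lintegral_lintegral_swap (Measurable.aemeasurable ?_)
    have hu : Measurable fun v' => w' u v' := hw'.comp measurable_prodMk_left
    exact F.2.comp (hw.comp ((hu.comp measurable_snd).prodMk measurable_fst))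

theorem commute_scale_assign {d : U → ℝ≥0∞} (hd : Measurable d) (κ : Kernel U V)
    [IsSFiniteKernel κ] {w : U → V → U} (hw : Measurable (Function.uncurry w))
    (h : ∀ u v, d (w u v) = d u) : Commute (scale d hd) (ofKernel (assign κ w)) :=
  op_ext fun F u => by
    have hu : Measurable fun v => F.1 (w u v) := F.2.comp (hw.comp measurable_prodMk_left)
    rw [mul_apply, mul_apply, scale_apply, ofKernel_assign_apply _ hw, ofKernel_assign_apply _ hw]
    simp_rw [scale_apply, h]
    rw [lintegral_const_mul _ hu]

/-- The drawn value can be read back from the memory after the write, so its density becomes a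
function `δ` of the new memory and can be split off as a separate factor. -/
theorem ofKernel_assign_drawDensity (ρ : Measure V) [SFinite ρ] {d : U → V → ℝ≥0}
    (hd : Measurable (Function.uncurry d)) {w : U → V → U} (hw : Measurable (Function.uncurry w))
    {δ : U → ℝ≥0} (hδ : Measurable δ) (h : ∀ u v, δ (w u v) = d u v) :
    ofKernel (assign (drawDensity ρ d) w) =
      ofKernel (assign (Kernel.const U ρ) w) * weight δ hδ := by
  have hd' : Measurable (Function.uncurry fun u v => (d u v : ℝ≥0∞)) := hd.coe_nnreal_ennreal
  have : IsSFiniteKernel (drawDensity ρ d) := by unfold drawDensity; infer_instance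
  refine op_ext fun F u => ?_
  have hu : Measurable fun v => F.1 (w u v) := F.2.comp (hw.comp measurable_prodMk_left)
  rw [mul_apply, ofKernel_assign_apply _ hw, ofKernel_assign_apply _ hw, drawDensity,
    Kernel.lintegral_withDensity _ hd' _ hu]
  simp_rw [weight, scale_apply, h]

theorem ofKernel_onlyIf_apply (P : U → Prop) (hP : MeasurableSet {u | P u}) (κ : Kernel U U)
    (F) (u : U) [Decidable (P u)] :
    (ofKernel (onlyIf P hP κ) F).1 u = if P u then (ofKernel κ F).1 u else F.1 u := by
  by_cases h : P u
  · have : onlyIf P hP κ u = κ u := by simp [onlyIf, Kernel.piecewise_apply, h]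
    rw [ofKernel_apply, this, if_pos h, ofKernel_apply]
  · have : onlyIf P hP κ u = Kernel.id u := by simp [onlyIf, Kernel.piecewise_apply, h]
    rw [ofKernel_apply, this, if_neg h, Kernel.id_apply, lintegral_dirac' _ F.2]

/-- The second step does not change the outcome of the test, so each branch can be treated alone. -/
theorem commute_onlyIf_assign (P : U → Prop) (hP : MeasurableSet {u | P u}) {κ : Kernel U U}
    (κ' : Kernel U V) [IsSFiniteKernel κ'] {w : U → V → U} (hw : Measurable (Function.uncurry w))
    (h : ∀ u v, P (w u v) ↔ P u) (hc : Commute (ofKernel κ) (ofKernel (assign κ' w))) :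
    Commute (ofKernel (onlyIf P hP κ)) (ofKernel (assign κ' w)) := by
  classical
  refine op_ext fun F u => ?_
  have hcu := congrFun (congrArg Subtype.val (congrFun hc F)) u
  rw [mul_apply, mul_apply, ofKernel_onlyIf_apply]
  split_ifs with hu
  · refine hcu.trans ((ofKernel_assign_apply _ hw _ u).trans (Eq.trans
      (lintegral_congr fun v => ?_) (ofKernel_assign_apply _ hw _ u).symm))
    exact ((ofKernel_onlyIf_apply P hP κ F (w u v)).trans (if_pos ((h u v).2 hu))).symm
  · refine (ofKernel_assign_apply _ hw F u).trans (Eq.trans (lintegral_congr fun v => ?_)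
      (ofKernel_assign_apply _ hw _ u).symm)
    exact ((ofKernel_onlyIf_apply P hP κ F (w u v)).trans (if_neg (mt (h u v).1 hu))).symm

/-! ### Operators that agree on an invariant set -/

/-- On the set `S`, the operators `T` and `T'` agree and depend on the values on `S` only. -/
def AgreeOn (S : Set U) (T T' : Op U) : Prop :=
  ∀ F G : {F : U → ℝ≥0∞ // Measurable F}, (∀ u ∈ S, F.1 u = G.1 u) →
    ∀ u ∈ S, (T F).1 u = (T' G).1 u

namespace AgreeOn

variable {S : Set U} {T T' T₁ T₁' : Op U}

theorem symm (h : AgreeOn S T T') : AgreeOn S T' T :=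
  fun F G hFG u hu => (h G F (fun v hv => (hFG v hv).symm) u hu).symm

theorem trans (h : AgreeOn S T T') (h' : AgreeOn S T' T₁) : AgreeOn S T T₁ :=
  fun F G hFG u hu => (h F F (fun _ _ => rfl) u hu).trans (h' F G hFG u hu)

theorem one : AgreeOn S (1 : Op U) 1 := fun _ _ h => h

theorem mul (h : AgreeOn S T T') (h₁ : AgreeOn S T₁ T₁') : AgreeOn S (T * T₁) (T' * T₁') :=
  fun F G hFG => h _ _ (h₁ F G hFG)

theorem list_prod {ι : Type*} {l : List ι} {f f' : ι → Op U}
    (h : ∀ i ∈ l, AgreeOn S (f i) (f' i)) : AgreeOn S (l.map f).prod (l.map f').prod := by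
  induction l with
  | nil => simpa using one
  | cons i l ih =>
    simp only [List.map_cons, List.prod_cons]
    exact (h i (by simp)).mul (ih fun j hj => h j (by simp [hj]))

theorem scale {d d' : U → ℝ≥0∞} (hd : Measurable d) (hd' : Measurable d')
    (h : ∀ u ∈ S, d u = d' u) : AgreeOn S (scale d hd) (scale d' hd') :=
  fun F G hFG u hu => by rw [scale_apply, scale_apply, h u hu, hFG u hu]

theorem assign (κ κ' : Kernel U V) [IsSFiniteKernel κ] [IsSFiniteKernel κ'] {w w' : U → V → U}
    (hw : Measurable (Function.uncurry w)) (hw' : Measurable (Function.uncurry w'))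
    (hκ : ∀ u ∈ S, κ u = κ' u) (h : ∀ u ∈ S, ∀ v, w u v = w' u v) (hS : ∀ u ∈ S, ∀ v, w u v ∈ S) :
    AgreeOn S (ofKernel (assign κ w)) (ofKernel (assign κ' w')) :=
  fun F G hFG u hu => by
    rw [ofKernel_assign_apply _ hw, ofKernel_assign_apply _ hw', ← hκ u hu]
    refine lintegral_congr fun v => ?_
    rw [← h u hu, hFG _ (hS u hu v)]

/-- On `S` the test has a constant outcome, so a branch at run time becomes a fixed choice between
two operators. -/
theorem onlyIf (P : U → Prop) (hP : MeasurableSet {u | P u}) {κ : Kernel U U} {Q : Prop}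
    [Decidable Q] (hQ : ∀ u ∈ S, (P u ↔ Q)) (h : AgreeOn S (ofKernel κ) T) :
    AgreeOn S (ofKernel (onlyIf P hP κ)) (if Q then T else 1) := by
  classical
  intro F G hFG u hu
  rw [ofKernel_onlyIf_apply]
  simp only [hQ u hu]
  split_ifs
  · exact h F G hFG u hu
  · exact hFG u hu

/-- Used with the fibres `u.b = b`, which cover the memory space. -/
theorem eq_of_forall {ι : Type*} {S : ι → Set U} (hS : ∀ u, ∃ i, u ∈ S i)
    (h : ∀ i, AgreeOn (S i) T T') : T = T' :=
  op_ext fun F u => by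
    obtain ⟨i, hi⟩ := hS u
    exact h i F F (fun _ _ => rfl) u hi

end AgreeOn

end Op

/-! ### Products of lists in a monoid -/

section ListProd

variable {M ι : Type*} [Monoid M]

theorem commute_list_prod {x : M} {l : List ι} {f : ι → M} (h : ∀ i ∈ l, Commute x (f i)) :
    Commute x (l.map f).prod := by
  refine Commute.list_prod_right _ _ fun y hy => ?_
  obtain ⟨i, hi, rfl⟩ := List.mem_map.1 hy
  exact h i hi

/-- Separating the factors moves each `g i` only past later `f j`, so one-sided commutation in list
order is enough. This is how all densities, MCMC runs and index draws are sorted. -/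
theorem list_prod_mul {l : List ι} {f g : ι → M}
    (h : l.Pairwise fun i j => Commute (g i) (f j)) :
    (l.map fun i => f i * g i).prod = (l.map f).prod * (l.map g).prod := by
  induction l with
  | nil => simp
  | cons i l ih =>
    rw [List.pairwise_cons] at h
    simp only [List.map_cons, List.prod_cons]
    rw [ih h.2, mul_assoc, mul_assoc, ← mul_assoc (g i), (commute_list_prod h.1).eq, mul_assoc]

theorem list_prod_ite_ne {m : ℕ} (b : Fin m) (f : Fin m → M) (h : ∀ i j, Commute (f i) (f j)) :
    ((List.finRange m).map fun i => if i ≠ b then f i else 1).prod * f b =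
      ((List.finRange m).map f).prod := by
  -- Padding the single factor with ones gives a product over the same list, so the two products
  -- merge factor by factor.
  have hb : f b = ((List.finRange m).map fun i => if i ≠ b then 1 else f i).prod := by
    rw [List.prod_map_eq_pow_single b _ (fun i hi _ => if_pos hi),
      List.count_eq_one_of_mem (List.nodup_finRange m) (List.mem_finRange b)]
    simp
  rw [hb, ← list_prod_mul]
  · congr 2
    funext i
    split_ifs <;> simp
  · refine List.pairwise_of_forall fun i j => ?_
    split_ifs <;> simp [h]

end ListProd

/-! ### Measurability of the assignments -/

/-- For reads and writes whose location is itself stored in the memory: there are only countably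
many locations, so each may be checked separately. -/
theorem measurable_apply_index {α β ι : Type*} [MeasurableSpace α] [MeasurableSpace β]
    [MeasurableSpace ι] [Countable ι] [MeasurableSingletonClass ι] {f : ι → α → β} {g : α → ι}
    (hf : ∀ i, Measurable (f i)) (hg : Measurable g) : Measurable fun p => f (g p) p := by
  have h : Measurable fun q : ι × α => f q.1 q.2 := measurable_from_prod_countable_right hf
  exact h.comp (hg.prodMk measurable_id)

theorem measurable_update_pi {α ι : Type*} {π : ι → Type*} [MeasurableSpace α]
    [∀ i, MeasurableSpace (π i)] [DecidableEq ι] {f : α → ∀ i, π i} (hf : Measurable f) (i : ι)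
    {g : α → π i} (hg : Measurable g) : Measurable fun p => Function.update (f p) i (g p) := by
  refine measurable_pi_iff.2 fun j => ?_
  by_cases h : j = i
  · subst h
    simpa using hg
  · simp only [Function.update_of_ne h]
    exact (measurable_pi_apply j).comp hf

/-! ### The memory: measurability, independence of writes to different slots, and locality -/

namespace Aug

section Measurability

variable {X : Type*} [MeasurableSpace X] {n : ℕ} {N : Fin (n + 1) → ℕ} {C : Fin n → ℕ}

theorem measurable_x : Measurable (x : Aug X N C → _) := measurable_fst

theorem measurable_a : Measurable (a : Aug X N C → _) := measurable_fst.comp measurable_snd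

theorem measurable_b : Measurable (b : Aug X N C → _) :=
  measurable_fst.comp (measurable_snd.comp measurable_snd)

theorem measurable_xt' : Measurable (xt : Aug X N C → _) :=
  measurable_snd.comp (measurable_snd.comp measurable_snd)

theorem measurable_x_apply (t : Fin (n + 1)) (i : Fin (N t)) :
    Measurable fun u : Aug X N C => u.x t i :=
  (measurable_pi_apply i).comp ((measurable_pi_apply t).comp measurable_x)

theorem measurable_a_apply (s : Fin n) (i : Fin (N s.succ)) :
    Measurable fun u : Aug X N C => u.a s i :=
  (measurable_pi_apply i).comp ((measurable_pi_apply s).comp measurable_a)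

theorem measurable_b_apply (t : Fin (n + 1)) : Measurable fun u : Aug X N C => u.b t :=
  (measurable_pi_apply t).comp measurable_b

theorem measurable_x_a (s : Fin n) (i : Fin (N s.succ)) :
    Measurable fun u : Aug X N C => u.x s.castSucc (u.a s i) :=
  measurable_apply_index (f := fun k (u : Aug X N C) => u.x s.castSucc k)
    (fun k => measurable_x_apply _ k) (measurable_a_apply s i)

theorem measurable_x_b (t : Fin (n + 1)) : Measurable fun u : Aug X N C => u.x t (u.b t) :=
  measurable_apply_index (f := fun k (u : Aug X N C) => u.x t k)
    (fun k => measurable_x_apply _ k) (measurable_b_apply t)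

theorem measurable_setX (t : Fin (n + 1)) (i : Fin (N t)) :
    Measurable (Function.uncurry (setX t i : Aug X N C → X → Aug X N C)) := by
  have hx : Measurable fun p : Aug X N C × X => p.1.x := measurable_x.comp measurable_fst
  exact (measurable_update_pi hx t (measurable_update_pi ((measurable_pi_apply t).comp hx) i
    measurable_snd)).prodMk (measurable_snd.comp measurable_fst)

theorem measurable_setX_b (t : Fin (n + 1)) :
    Measurable (Function.uncurry fun (u : Aug X N C) (v : X) => setX t (u.b t) u v) :=
  measurable_apply_index (f := fun k (p : Aug X N C × X) => setX t k p.1 p.2)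
    (fun k => measurable_setX t k) ((measurable_b_apply t).comp measurable_fst)

theorem measurable_setA (s : Fin n) (i : Fin (N s.succ)) :
    Measurable (Function.uncurry (setA s i : Aug X N C → _ → Aug X N C)) := by
  have ha : Measurable fun p : Aug X N C × Fin (N s.castSucc) => p.1.a :=
    measurable_a.comp measurable_fst
  exact (measurable_fst.comp measurable_fst).prodMk ((measurable_update_pi ha s
    (measurable_update_pi ((measurable_pi_apply s).comp ha) i measurable_snd)).prodMk
      (measurable_snd.comp (measurable_snd.comp measurable_fst)))

theorem measurable_setA_b (s : Fin n) :
    Measurable (Function.uncurry fun (u : Aug X N C) k => setA s (u.b s.succ) u k) :=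
  measurable_apply_index
    (f := fun i (p : Aug X N C × Fin (N s.castSucc)) => setA s i p.1 p.2)
    (fun i => measurable_setA s i) ((measurable_b_apply s.succ).comp measurable_fst)

theorem measurable_setB (t : Fin (n + 1)) :
    Measurable (Function.uncurry (setB t : Aug X N C → _ → Aug X N C)) := by
  have hb : Measurable fun p : Aug X N C × Fin (N t) => p.1.b := measurable_b.comp measurable_fst
  exact (measurable_fst.comp measurable_fst).prodMk ((measurable_a.comp measurable_fst).prodMk
    ((measurable_update_pi hb t measurable_snd).prodMk (measurable_xt'.comp measurable_fst)))

theorem measurable_setXt (s : Fin n) (j : Fin (C s)) :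
    Measurable (Function.uncurry (setXt s j : Aug X N C → X → Aug X N C)) := by
  have hx : Measurable fun p : Aug X N C × X => p.1.xt := measurable_xt'.comp measurable_fst
  exact (measurable_fst.comp measurable_fst).prodMk ((measurable_a.comp measurable_fst).prodMk
    ((measurable_b.comp measurable_fst).prodMk (measurable_update_pi hx s
      (measurable_update_pi ((measurable_pi_apply s).comp hx) j measurable_snd))))

theorem measurable_retState (hC : ∀ s, 0 < C s) :
    Measurable (retState hC : Aug X N C → Fin (n + 1) → X) := by
  refine measurable_pi_iff.2 fun t => ?_
  refine Fin.lastCases ?_ (fun s => ?_) t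
  · simpa [retState] using measurable_x_b (X := X) (C := C) (Fin.last n)
  · simpa [retState] using measurable_xt s _

theorem measurable_ret (hC : ∀ s, 0 < C s) : Measurable (ret hC : Aug X N C → Ret X N) :=
  (measurable_retState hC).prodMk (measurable_b_apply _)

/-- Overwrite all backward indices. -/
def fixB (b : (t : Fin (n + 1)) → Fin (N t)) (u : Aug X N C) : Aug X N C := (u.x, u.a, b, u.xt)

theorem measurable_fixB (b : (t : Fin (n + 1)) → Fin (N t)) :
    Measurable (fixB b : Aug X N C → Aug X N C) :=
  measurable_x.prodMk (measurable_a.prodMk (measurable_const.prodMk measurable_xt'))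

end Measurability

variable {X : Type*} {n : ℕ} {N : Fin (n + 1) → ℕ} {C : Fin n → ℕ}

theorem fixB_eq {b : (t : Fin (n + 1)) → Fin (N t)} {u : Aug X N C} (h : u.b = b) :
    fixB b u = u := by
  subst h; rfl

/-! ### Reading after writing -/

theorem x_setX_self (t : Fin (n + 1)) (i : Fin (N t)) (u : Aug X N C) (v : X) :
    (setX t i u v).x t i = v := by
  simp [setX, x]

theorem x_setX_of_ne {t t' : Fin (n + 1)} (h : t' ≠ t) (i : Fin (N t)) (u : Aug X N C) (v : X) :
    (setX t i u v).x t' = u.x t' := by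
  simp [setX, x, h]

theorem x_setX_index_of_ne {t : Fin (n + 1)} {i i' : Fin (N t)} (h : i' ≠ i) (u : Aug X N C)
    (v : X) : (setX t i u v).x t i' = u.x t i' := by
  simp [setX, x, h]

theorem a_setA_self (s : Fin n) (i : Fin (N s.succ)) (u : Aug X N C) (k) :
    (setA s i u k).a s i = k := by
  simp [setA, a]

theorem a_setA_of_ne {s s' : Fin n} (h : s' ≠ s) (i : Fin (N s.succ)) (u : Aug X N C) (k) :
    (setA s i u k).a s' = u.a s' := by
  simp [setA, a, h]

theorem a_setA_index_of_ne {s : Fin n} {i i' : Fin (N s.succ)} (h : i' ≠ i) (u : Aug X N C) (k) :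
    (setA s i u k).a s i' = u.a s i' := by
  simp [setA, a, h]

theorem b_setB_of_ne {t t' : Fin (n + 1)} (h : t' ≠ t) (u : Aug X N C) (k) :
    (setB t u k).b t' = u.b t' := by
  simp [setB, b, h]

theorem xt_setXt_of_ne {s s' : Fin n} (h : s' ≠ s) (j : Fin (C s)) (u : Aug X N C) (v : X) :
    (setXt s j u v).xt s' = u.xt s' := by
  simp [setXt, xt, h]

theorem xt_setXt_index_of_ne {s : Fin n} {j j' : Fin (C s)} (h : j' ≠ j) (u : Aug X N C) (v : X) :
    (setXt s j u v).xt s j' = u.xt s j' := by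
  simp [setXt, xt, h]

theorem setX_comm {t t' : Fin (n + 1)} {i : Fin (N t)} {i' : Fin (N t')}
    (h : (⟨t, i⟩ : Σ t, Fin (N t)) ≠ ⟨t', i'⟩) (u : Aug X N C) (v v' : X) :
    setX t' i' (setX t i u v) v' = setX t i (setX t' i' u v') v := by
  refine Prod.ext ?_ rfl
  change Function.update (Function.update u.x t _) t' _ =
    Function.update (Function.update u.x t' _) t _
  by_cases ht : t = t'
  · subst ht
    have hi : i ≠ i' := fun hi => h (by rw [hi])
    simp [setX, x, Function.update_comm hi]
  · simp [setX, x, Function.update_comm ht, ht, Ne.symm ht]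

theorem setA_comm {s s' : Fin n} {i : Fin (N s.succ)} {i' : Fin (N s'.succ)}
    (h : (⟨s, i⟩ : Σ s : Fin n, Fin (N s.succ)) ≠ ⟨s', i'⟩) (u : Aug X N C) (k k') :
    setA s' i' (setA s i u k) k' = setA s i (setA s' i' u k') k := by
  refine Prod.ext rfl (Prod.ext ?_ rfl)
  change Function.update (Function.update u.a s _) s' _ =
    Function.update (Function.update u.a s' _) s _
  by_cases hs : s = s'
  · subst hs
    have hi : i ≠ i' := fun hi => h (by rw [hi])
    simp [setA, a, Function.update_comm hi]
  · simp [setA, a, Function.update_comm hs, hs, Ne.symm hs]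

theorem retState_castSucc (hC : ∀ s, 0 < C s) (u : Aug X N C) (s : Fin n) :
    u.retState hC s.castSucc = u.xt s ⟨C s - 1, Nat.sub_lt (hC s) Nat.one_pos⟩ := by
  simp [retState]

theorem retState_last (hC : ∀ s, 0 < C s) (u : Aug X N C) :
    u.retState hC (Fin.last n) = u.x (Fin.last n) (u.b (Fin.last n)) := by
  simp [retState]

theorem retState_congr (hC : ∀ s, 0 < C s) {u v : Aug X N C}
    (h : ∀ s, u.xt s ⟨C s - 1, Nat.sub_lt (hC s) Nat.one_pos⟩ =
      v.xt s ⟨C s - 1, Nat.sub_lt (hC s) Nat.one_pos⟩)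
    (hl : u.x (Fin.last n) (u.b (Fin.last n)) = v.x (Fin.last n) (v.b (Fin.last n))) :
    u.retState hC = v.retState hC := by
  funext t
  refine Fin.lastCases ?_ (fun s => ?_) t
  · rw [retState_last, retState_last, hl]
  · rw [retState_castSucc, retState_castSucc, h]

theorem ret_init (hN : ∀ t, 0 < N t) (hC : ∀ s, 0 < C s) (r : Ret X N) :
    (init hN r : Aug X N C).ret hC = r := by
  refine Prod.ext (funext fun t => ?_) ?_
  · change (init hN r : Aug X N C).retState hC t = r.1 t
    refine Fin.lastCases ?_ (fun s => ?_) t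
    · rw [retState_last]; rfl
    · rw [retState_castSucc]; rfl
  · simp [ret, init, b]

/-! ### Agreement up to a time -/

/-- `u` and `v` have the same particles up to time `t`, and these have the same parents. -/
def AgreeUpTo (t : Fin (n + 1)) (u v : Aug X N C) : Prop :=
  (∀ t' ≤ t, u.x t' = v.x t') ∧ ∀ s : Fin n, s.succ ≤ t → u.a s = v.a s

/-- `u` and `v` have the same particles before time `t`, the same particle `i` at time `t`, and
all of these have the same parents. -/
def SameParticle (t : Fin (n + 1)) (i : Fin (N t)) (u v : Aug X N C) : Prop :=
  (∀ p : Σ t, Fin (N t), p.1 < t ∨ p = ⟨t, i⟩ → u.x p.1 p.2 = v.x p.1 p.2) ∧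
  ∀ (s : Fin n) (j : Fin (N s.succ)),
    s.succ < t ∨ (⟨s.succ, j⟩ : Σ t, Fin (N t)) = ⟨t, i⟩ → u.a s j = v.a s j

theorem SameParticle.x {t : Fin (n + 1)} {i : Fin (N t)} {u v : Aug X N C}
    (h : SameParticle t i u v) : u.x t i = v.x t i :=
  h.1 ⟨t, i⟩ (Or.inr rfl)

theorem SameParticle.a {s : Fin n} {i : Fin (N s.succ)} {u v : Aug X N C}
    (h : SameParticle s.succ i u v) : u.a s i = v.a s i :=
  h.2 s i (Or.inr rfl)

theorem SameParticle.agreeUpTo {s : Fin n} {i : Fin (N s.succ)} {u v : Aug X N C}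
    (h : SameParticle s.succ i u v) : AgreeUpTo s.castSucc u v :=
  ⟨fun t ht => funext fun j => h.1 ⟨t, j⟩ (Or.inl (ht.trans_lt Fin.castSucc_lt_succ)),
    fun r hr => funext fun j => h.2 r j (Or.inl (hr.trans_lt Fin.castSucc_lt_succ))⟩

theorem sameParticle_setX {t t' : Fin (n + 1)} {i : Fin (N t)} {j : Fin (N t')} (h : t ≤ t')
    (hij : (⟨t, i⟩ : Σ t, Fin (N t)) ≠ ⟨t', j⟩) (u : Aug X N C) (v : X) :
    SameParticle t i (setX t' j u v) u := by
  refine ⟨fun p hp => ?_, fun _ _ _ => rfl⟩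
  have hne : p ≠ ⟨t', j⟩ := by
    rcases hp with hp | rfl
    · rintro rfl
      exact (hp.trans_le h).false
    · exact hij
  obtain ⟨r, k⟩ := p
  by_cases hr : r = t'
  · subst hr
    exact x_setX_index_of_ne (fun hk => hne (congrArg (Sigma.mk r) hk)) u v
  · exact congrFun (x_setX_of_ne hr j u v) k

theorem sameParticle_setA {t : Fin (n + 1)} {s : Fin n} {i : Fin (N t)} {j : Fin (N s.succ)}
    (h : t ≤ s.succ) (hij : (⟨t, i⟩ : Σ t, Fin (N t)) ≠ ⟨s.succ, j⟩) (u : Aug X N C) (k) :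
    SameParticle t i (setA s j u k) u := by
  refine ⟨fun _ _ => rfl, fun r l hr => ?_⟩
  by_cases hs : r = s
  · subst hs
    refine a_setA_index_of_ne ?_ u k
    rintro rfl
    rcases hr with hr | hr
    · exact (hr.trans_le h).false
    · exact hij hr.symm
  · exact congrFun (a_setA_of_ne hs j u k) l

theorem sameParticle_setXt (t : Fin (n + 1)) (i : Fin (N t)) (s : Fin n) (j : Fin (C s))
    (u : Aug X N C) (v : X) : SameParticle t i (setXt s j u v) u :=
  ⟨fun _ _ => rfl, fun _ _ _ => rfl⟩

theorem sameParticle_setB (t : Fin (n + 1)) (i : Fin (N t)) (t' : Fin (n + 1)) (u : Aug X N C)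
    (k) : SameParticle t i (setB t' u k) u :=
  ⟨fun _ _ => rfl, fun _ _ _ => rfl⟩

theorem agreeUpTo_setA {t : Fin (n + 1)} {s : Fin n} (h : t < s.succ) (i : Fin (N s.succ))
    (u : Aug X N C) (k) : AgreeUpTo t (setA s i u k) u :=
  ⟨fun _ _ => rfl, fun r hr => a_setA_of_ne (by rintro rfl; exact (hr.trans_lt h).false) i u k⟩

theorem agreeUpTo_setX {t t' : Fin (n + 1)} (h : t < t') (i : Fin (N t')) (u : Aug X N C) (v : X) :
    AgreeUpTo t (setX t' i u v) u :=
  ⟨fun _ hr => x_setX_of_ne (hr.trans_lt h).ne i u v, fun _ _ => rfl⟩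

/-- The kernel sees particles of later times only through the next retained state. That state is a
particle only at the final time, where it has number `b t`; this is what `hi` excludes. -/
theorem condAgree_fixB_setX {b : (t : Fin (n + 1)) → Fin (N t)} {s : Fin n} {t : Fin (n + 1)} (h : s.castSucc < t)
    {i : Fin (N t)} (hi : i ≠ b t) (hC : ∀ s, 0 < C s) (u : Aug X N C) (v : X) :
    CondAgree hC s (fixB b (setX t i u v)) (fixB b u) := by
  refine ⟨rfl, fun t' ht' i' _ => congrFun (x_setX_of_ne (ht'.trans_lt h).ne i u v) i',
    fun _ _ _ _ => rfl, congrFun (retState_congr (u := fixB b (setX t i u v)) (v := fixB b u) hC (fun _ => rfl) ?_) _⟩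
  change (setX t i u v).x (Fin.last n) (b (Fin.last n)) = u.x (Fin.last n) (b (Fin.last n))
  by_cases ht : Fin.last n = t
  · subst ht
    exact x_setX_index_of_ne hi.symm u v
  · exact congrFun (x_setX_of_ne ht i u v) _

/-- The conditioning omits the parent of particle `b` at the kernel's own time and all ancestor
indices of later times. The first omission is what lets the algorithm draw that parent after the
MCMC run. -/
theorem condAgree_fixB_setA {b : (t : Fin (n + 1)) → Fin (N t)} {s r : Fin n} {i : Fin (N r.succ)}
    (h : r.succ ≤ s.castSucc → i = b r.succ ∧ r.succ = s.castSucc) (hC : ∀ s, 0 < C s)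
    (u : Aug X N C) (k) : CondAgree hC s (fixB b (setA r i u k)) (fixB b u) := by
  refine ⟨rfl, fun _ _ _ _ => rfl, fun q hq i' hi' => ?_, rfl⟩
  by_cases hqr : q = r
  · subst hqr
    obtain ⟨rfl, hs⟩ := h hq
    exact a_setA_index_of_ne (hi' hs) u k
  · exact congrFun (a_setA_of_ne hqr i u k) i'

end Aug

/-! ### Weights and draw densities: positivity, normalization, and the variables they depend on -/

namespace Model

variable {X Y : Type*} [MeasurableSpace X] {μ : Measure X} {n : ℕ}
  {N : Fin (n + 1) → ℕ} {C : Fin n → ℕ} (m : Model X Y μ n N C)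

open Aug

/-! ### Weights and densities -/

theorem w_zero (u : Aug X N C) (i : Fin (N 0)) :
    m.w u 0 i = m.g 0 (m.y 0) (u.x 0 i) * m.f₁ (u.x 0 i) / m.M₁ (m.y 0) (u.x 0 i) := rfl

theorem w_succ (u : Aug X N C) (s : Fin n) (i : Fin (N s.succ)) :
    m.w u s.succ i = m.g s.succ (m.y s.succ) (u.x s.succ i) *
          m.f s (u.x s.castSucc (u.a s i)) (u.x s.succ i) /
        m.M s (m.y s.succ) (u.x s.castSucc (u.a s i)) (u.x s.succ i) := rfl

theorem w_pos (u : Aug X N C) (t : Fin (n + 1)) (i : Fin (N t)) : 0 < m.w u t i := by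
  revert i
  refine Fin.cases (fun i => ?_) (fun s i => ?_) t
  · rw [w_zero]
    exact div_pos (mul_pos (m.g_pos _ _ _) (m.f₁_pos _)) (m.M₁_pos _ _)
  · rw [w_succ]
    exact div_pos (mul_pos (m.g_pos _ _ _) (m.f_pos _ _ _)) (m.M_pos _ _ _ _)

theorem measurable_w (t : Fin (n + 1)) (i : Fin (N t)) : Measurable fun u => m.w u t i := by
  revert i
  refine Fin.cases (fun i => ?_) (fun s i => ?_) t
  · simp only [w_zero]
    have hx := measurable_x_apply (X := X) (C := C) 0 i
    exact (((m.g_meas _ _).comp hx).mul (m.f₁_meas.comp hx)).div ((m.M₁_meas _).comp hx)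
  · simp only [w_succ]
    have hx := measurable_x_apply (X := X) (C := C) s.succ i
    have hp := (measurable_x_a (X := X) (C := C) s i).prodMk hx
    exact (((m.g_meas _ _).comp hx).mul ((m.f_meas s).comp hp)).div ((m.M_meas s _).comp hp)

theorem measurable_W (t : Fin (n + 1)) (i : Fin (N t)) : Measurable fun u => m.W u t i :=
  (m.measurable_w t i).div (Finset.measurable_fun_sum _ fun j _ => m.measurable_w t j)

theorem measurable_v (s : Fin n) (i : Fin (N s.castSucc)) : Measurable fun u => m.v u s i :=
  (m.measurable_w _ i).mul
    ((m.f_meas s).comp ((measurable_x_apply _ i).prodMk (measurable_x_b s.succ)))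

theorem measurable_V (s : Fin n) (i : Fin (N s.castSucc)) : Measurable fun u => m.V u s i :=
  (m.measurable_v s i).div (Finset.measurable_fun_sum _ fun j _ => m.measurable_v s j)

theorem measurable_M (s : Fin n) (i : Fin (N s.succ)) :
    Measurable (Function.uncurry fun (u : Aug X N C) x' =>
      m.M s (m.y s.succ) (u.x s.castSucc (u.a s i)) x') :=
  (m.M_meas s _).comp
    (((measurable_x_a (X := X) (C := C) s i).comp measurable_fst).prodMk measurable_snd)

theorem w_congr {t : Fin (n + 1)} {u v : Aug X N C} (h : AgreeUpTo t u v) : m.w u t = m.w v t := by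
  revert h
  refine Fin.cases (fun h => ?_) (fun s h => ?_) t
  · funext i
    rw [w_zero, w_zero, h.1 0 le_rfl]
  · funext i
    rw [w_succ, w_succ, h.1 _ le_rfl, h.1 _ (Fin.castSucc_lt_succ).le, h.2 s le_rfl]

theorem W_congr {t : Fin (n + 1)} {u v : Aug X N C} (h : AgreeUpTo t u v) : m.W u t = m.W v t := by
  funext i
  rw [W, W, m.w_congr h]

theorem V_congr {s : Fin n} {u v : Aug X N C} (h : AgreeUpTo s.castSucc u v)
    (hx : u.x s.succ (u.b s.succ) = v.x s.succ (v.b s.succ)) : m.V u s = m.V v s := by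
  funext i
  simp only [V, Model.v, m.w_congr h, hx, h.1 _ le_rfl]

theorem sum_W (u : Aug X N C) (t : Fin (n + 1)) : ∑ i, m.W u t i = 1 := by
  have : Nonempty (Fin (N t)) := ⟨⟨0, m.hN t⟩⟩
  simp only [W]
  rw [← Finset.sum_div]
  exact div_self (Finset.sum_pos (fun i _ => m.w_pos u t i) Finset.univ_nonempty).ne'

theorem v_pos (u : Aug X N C) (s : Fin n) (i : Fin (N s.castSucc)) : 0 < m.v u s i :=
  mul_pos (m.w_pos _ _ _) (m.f_pos _ _ _)

theorem sum_V (u : Aug X N C) (s : Fin n) : ∑ i, m.V u s i = 1 := by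
  have : Nonempty (Fin (N s.castSucc)) := ⟨⟨0, m.hN _⟩⟩
  simp only [V]
  rw [← Finset.sum_div]
  exact div_self (Finset.sum_pos (fun i _ => m.v_pos u s i) Finset.univ_nonempty).ne'

theorem W_pos (u : Aug X N C) (t : Fin (n + 1)) (i : Fin (N t)) : 0 < m.W u t i :=
  div_pos (m.w_pos u t i) (Finset.sum_pos (fun i _ => m.w_pos u t i) ⟨i, Finset.mem_univ i⟩)

/-- The density of the draw of particle `i` at time `t` together with its parent. -/
def particleDensity (u : Aug X N C) : (t : Fin (n + 1)) → Fin (N t) → ℝ≥0 :=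
  Fin.cases (fun i => m.M₁ (m.y 0) (u.x 0 i))
    (fun s i => m.W u s.castSucc (u.a s i) *
      m.M s (m.y s.succ) (u.x s.castSucc (u.a s i)) (u.x s.succ i))

/-- The density of the draw of the parent of particle `b t` at time `t`. -/
def parentDensity (b : (t : Fin (n + 1)) → Fin (N t)) (u : Aug X N C) : Fin (n + 1) → ℝ≥0 :=
  Fin.cases 1 (fun s => m.V (fixB b u) s (u.a s (b s.succ)))

theorem particleDensity_zero (u : Aug X N C) (i : Fin (N 0)) :
    m.particleDensity u 0 i = m.M₁ (m.y 0) (u.x 0 i) := rfl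

theorem particleDensity_succ (u : Aug X N C) (s : Fin n) (i : Fin (N s.succ)) :
    m.particleDensity u s.succ i = m.W u s.castSucc (u.a s i) *
      m.M s (m.y s.succ) (u.x s.castSucc (u.a s i)) (u.x s.succ i) := rfl

theorem parentDensity_succ (b : (t : Fin (n + 1)) → Fin (N t)) (u : Aug X N C) (s : Fin n) :
    m.parentDensity b u s.succ = m.V (fixB b u) s (u.a s (b s.succ)) := rfl

theorem particleDensity_pos (u : Aug X N C) (t : Fin (n + 1)) (i : Fin (N t)) :
    0 < m.particleDensity u t i := by
  revert i
  refine Fin.cases (fun i => ?_) (fun s i => ?_) t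
  · exact m.M₁_pos _ _
  · exact mul_pos (m.W_pos _ _ _) (m.M_pos _ _ _ _)

theorem particleDensity_congr {t : Fin (n + 1)} {i : Fin (N t)} {u v : Aug X N C}
    (h : SameParticle t i u v) : m.particleDensity u t i = m.particleDensity v t i := by
  induction t using Fin.cases with
  | zero => rw [particleDensity_zero, particleDensity_zero, h.x]
  | succ s =>
    rw [particleDensity_succ, particleDensity_succ, h.x, h.a, h.agreeUpTo.1 _ le_rfl,
      m.W_congr h.agreeUpTo]

theorem parentDensity_congr {b : (t : Fin (n + 1)) → Fin (N t)} {t : Fin (n + 1)} {u v : Aug X N C}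
    (h : SameParticle t (b t) u v) : m.parentDensity b u t = m.parentDensity b v t := by
  revert h
  refine Fin.cases (fun _ => ?_) (fun s h => ?_) t
  · rfl
  · have h' : AgreeUpTo s.castSucc (fixB b u) (fixB b v) := h.agreeUpTo
    rw [parentDensity_succ, parentDensity_succ, h.a, m.V_congr h' h.x]

theorem measurable_W_a (s : Fin n) (i : Fin (N s.succ)) :
    Measurable fun u : Aug X N C => m.W u s.castSucc (u.a s i) :=
  measurable_apply_index (f := fun k (u : Aug X N C) => m.W u s.castSucc k)
    (fun k => m.measurable_W _ k) (measurable_a_apply s i)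

theorem measurable_M_x (s : Fin n) (i : Fin (N s.succ)) :
    Measurable fun u : Aug X N C =>
      m.M s (m.y s.succ) (u.x s.castSucc (u.a s i)) (u.x s.succ i) :=
  (m.M_meas s _).comp ((measurable_x_a s i).prodMk (measurable_x_apply _ i))

theorem measurable_particleDensity (t : Fin (n + 1)) (i : Fin (N t)) :
    Measurable fun u => m.particleDensity u t i := by
  revert i
  refine Fin.cases (fun i => ?_) (fun s i => ?_) t
  · exact (m.M₁_meas _).comp (measurable_x_apply _ i)
  · exact (m.measurable_W_a s i).mul (m.measurable_M_x s i)

theorem measurable_parentDensity (b : (t : Fin (n + 1)) → Fin (N t)) (t : Fin (n + 1)) :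
    Measurable fun u => m.parentDensity b u t := by
  refine Fin.cases ?_ (fun s => ?_) t
  · exact measurable_const
  · exact measurable_apply_index (f := fun k (u : Aug X N C) => m.V (fixB b u) s k)
      (fun k => (m.measurable_V _ k).comp (measurable_fixB b)) (measurable_a_apply s _)

end Model

/-! ### Elementary integrations for constant backward indices and their commutation -/

namespace Model

variable {X Y : Type*} [MeasurableSpace X] {μ : Measure X} {n : ℕ}
  {N : Fin (n + 1) → ℕ} {C : Fin n → ℕ} (m : Model X Y μ n N C)

open Aug Op

instance isMarkovKernel_K (s : Fin n) : IsMarkovKernel (m.K s) := m.K_markov s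

instance isSFiniteKernel_drawDensity {U V : Type*} [MeasurableSpace U] [MeasurableSpace V]
    (ρ : Measure V) [SFinite ρ] (d : U → V → ℝ≥0) : IsSFiniteKernel (drawDensity ρ d) := by
  unfold drawDensity; infer_instance

/-! ### The steps with fixed backward indices -/

/-- Integrate over particle `x t i`. -/
def particleOp (μ : Measure X) (t : Fin (n + 1)) (i : Fin (N t)) : Op (Aug X N C) :=
  ofKernel (assign (Kernel.const _ μ) (setX t i))

/-- Sum over the ancestor index `a s i`. -/
def ancestorOp (s : Fin n) (i : Fin (N s.succ)) : Op (Aug X N C) :=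
  ofKernel (assign (Kernel.const _ Measure.count) (setA s i))

/-- Sum over the ancestor index of particle `i` at time `t`, if `t` is not the first time. -/
def parentOp : (t : Fin (n + 1)) → Fin (N t) → Op (Aug X N C) :=
  Fin.cases (fun _ => 1) (fun s i => ancestorOp s i)

/-- Sum over the backward index `b t`. -/
def indexOp (t : Fin (n + 1)) : Op (Aug X N C) :=
  ofKernel (assign (Kernel.const _ Measure.count) (setB t))

theorem measurable_xt_fixB (b : (t : Fin (n + 1)) → Fin (N t)) (s : Fin n) (j : Fin (C s)) :
    Measurable fun u : Aug X N C => (u.xt s j, fixB b u) :=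
  (measurable_xt s j).prodMk (measurable_fixB b)

variable (b : (t : Fin (n + 1)) → Fin (N t))

/-- The law of the MCMC state after `xt s j`, if the backward indices are `b`. -/
def mcmcKernel (s : Fin n) (j : Fin (C s)) : Kernel (Aug X N C) X :=
  (m.K s).comap (fun u => (u.xt s j, fixB b u)) (measurable_xt_fixB b s j)

instance (s : Fin n) (j : Fin (C s)) : IsMarkovKernel (m.mcmcKernel b s j) := by
  unfold mcmcKernel; infer_instance

/-- Integrate over the MCMC state `xt s j'`, given `xt s j`. -/
def mcmcOp (s : Fin n) (j j' : Fin (C s)) : Op (Aug X N C) :=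
  ofKernel (assign (m.mcmcKernel b s j) (setXt s j'))

/-- Integrate over the particle `x t (b t)`, `t = s.castSucc`, given `xt s 0`. -/
def mcmcEndOp (s : Fin n) : Op (Aug X N C) :=
  ofKernel (assign (m.mcmcKernel b s ⟨0, m.hC s⟩) (setX s.castSucc (b s.castSucc)))

/-- Integrate over the whole MCMC run. -/
def backwardOp (s : Fin n) : Op (Aug X N C) :=
  ((List.finRange (C s - 1)).reverse.map fun k : Fin (C s - 1) =>
    m.mcmcOp b s ⟨(k : ℕ) + 1, by have := k.2; omega⟩ ⟨(k : ℕ), by have := k.2; omega⟩).prod *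
  m.mcmcEndOp b s

/-! ### Commutation of the steps -/

section Commute

variable {b}

theorem commute_scale_ancestorOp {d : Aug X N C → ℝ≥0∞} (hd : Measurable d) {s : Fin n}
    {i : Fin (N s.succ)} (h : ∀ u k, d (setA s i u k) = d u) :
    Commute (scale d hd) (ancestorOp s i) :=
  commute_scale_assign hd _ (measurable_setA s i) h

/-- Different slots are covered by Tonelli. For equal slots the writes do not commute, but the
operators coincide, so no side condition is needed. -/
theorem commute_ancestorOp (s s' : Fin n) (i : Fin (N s.succ)) (i' : Fin (N s'.succ)) :
    Commute (ancestorOp s i : Op (Aug X N C)) (ancestorOp s' i') := by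
  by_cases h : (⟨s, i⟩ : Σ s : Fin n, Fin (N s.succ)) = ⟨s', i'⟩
  · obtain ⟨rfl, h⟩ := Sigma.mk.inj_iff.1 h
    rw [eq_of_heq h]
  · exact commute_assign_assign _ _ (measurable_setA s i) (measurable_setA s' i')
      (fun _ _ => rfl) (fun _ _ => rfl) (setA_comm h)

theorem mcmcKernel_congr (s : Fin n) (j : Fin (C s)) {u v : Aug X N C}
    (h : CondAgree m.hC s (fixB b u) (fixB b v)) (hj : u.xt s j = v.xt s j) :
    m.mcmcKernel b s j u = m.mcmcKernel b s j v := by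
  rw [mcmcKernel, Kernel.comap_apply, Kernel.comap_apply, hj, m.K_cond s _ _ _ h]

/-- The run writes the states with indices `0, …, C s - 2` and one particle, but never the last
state, which is retained. Commutation with a write to that last state is therefore not required. -/
theorem commute_backwardOp_of {T : Op (Aug X N C)} {s : Fin n}
    (h : ∀ j j', j' ≠ ⟨C s - 1, Nat.sub_lt (m.hC s) Nat.one_pos⟩ → Commute T (m.mcmcOp b s j j'))
    (h' : Commute T (m.mcmcEndOp b s)) : Commute T (m.backwardOp b s) := by
  refine (commute_list_prod fun k _ => h _ _ fun hk => ?_).mul_right h'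
  have h1 := Fin.mk.inj_iff.1 hk
  have h2 := k.2
  omega

theorem commute_backwardOp_ancestorOp {s r : Fin n} {i : Fin (N r.succ)}
    (h : r.succ ≤ s.castSucc → i = b r.succ ∧ r.succ = s.castSucc) :
    Commute (m.backwardOp b s) (ancestorOp r i) := by
  refine (m.commute_backwardOp_of (fun j j' _ => ?_) ?_).symm
  · exact commute_assign_assign _ _ (measurable_setA r i) (measurable_setXt s j')
      (fun _ _ => rfl) (fun u k => m.mcmcKernel_congr s j (condAgree_fixB_setA h _ u k) rfl)
      (fun _ _ _ => rfl)
  · exact commute_assign_assign _ _ (measurable_setA r i) (measurable_setX _ _)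
      (fun _ _ => rfl) (fun u k => m.mcmcKernel_congr s _ (condAgree_fixB_setA h _ u k) rfl)
      (fun _ _ _ => rfl)

theorem commute_scale_backwardOp {d : Aug X N C → ℝ≥0∞} (hd : Measurable d) {s : Fin n}
    (h : ∀ u j v, j ≠ ⟨C s - 1, Nat.sub_lt (m.hC s) Nat.one_pos⟩ → d (setXt s j u v) = d u)
    (h' : ∀ u v, d (setX s.castSucc (b s.castSucc) u v) = d u) :
    Commute (scale d hd) (m.backwardOp b s) :=
  m.commute_backwardOp_of
    (fun _ j' hj => commute_scale_assign hd _ (measurable_setXt s j') fun u v => h u j' v hj)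
    (commute_scale_assign hd _ (measurable_setX _ _) h')

section SFinite

variable [SFinite μ]

theorem commute_scale_particleOp {d : Aug X N C → ℝ≥0∞} (hd : Measurable d) {t : Fin (n + 1)}
    {i : Fin (N t)} (h : ∀ u v, d (setX t i u v) = d u) :
    Commute (scale d hd) (particleOp μ t i) :=
  commute_scale_assign hd _ (measurable_setX t i) h

theorem commute_particleOp_ancestorOp (t : Fin (n + 1)) (i : Fin (N t)) (s : Fin n)
    (i' : Fin (N s.succ)) : Commute (particleOp μ t i : Op (Aug X N C)) (ancestorOp s i') :=
  commute_assign_assign _ _ (measurable_setX t i) (measurable_setA s i')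
    (fun _ _ => rfl) (fun _ _ => rfl) (fun _ _ _ => rfl)

theorem commute_backwardOp_particleOp {s : Fin n} {t : Fin (n + 1)} (h : s.castSucc < t)
    {i : Fin (N t)} (hi : i ≠ b t) : Commute (m.backwardOp b s) (particleOp μ t i) := by
  refine (m.commute_backwardOp_of (fun j j' _ => ?_) ?_).symm
  · exact commute_assign_assign _ _ (measurable_setX t i) (measurable_setXt s j')
      (fun _ _ => rfl) (fun u v => m.mcmcKernel_congr s j (condAgree_fixB_setX h hi _ u v) rfl)
      (fun _ _ _ => rfl)
  · exact commute_assign_assign _ _ (measurable_setX t i) (measurable_setX _ _)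
      (fun _ _ => rfl) (fun u v => m.mcmcKernel_congr s _ (condAgree_fixB_setX h hi _ u v) rfl)
      (setX_comm fun heq => h.ne' (congrArg Sigma.fst heq))

end SFinite

/-- Treats the first time, which has no parents, together with the others. The equality in the sigma
type identifies time and particle number at once, so side conditions on `(t, i)` can be transported.
-/
theorem parentOp_induction {p : Op (Aug X N C) → Prop} (h1 : p 1) {t : Fin (n + 1)} {i : Fin (N t)}
    (h : ∀ (s : Fin n) (j : Fin (N s.succ)), (⟨s.succ, j⟩ : Σ t, Fin (N t)) = ⟨t, i⟩ →
      p (ancestorOp s j)) : p (parentOp t i) := by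
  induction t using Fin.cases with
  | zero => exact h1
  | succ s => exact h s i rfl

theorem commute_parentOp (t t' : Fin (n + 1)) (i : Fin (N t)) (i' : Fin (N t')) :
    Commute (parentOp t i : Op (Aug X N C)) (parentOp t' i') :=
  parentOp_induction (p := fun T => Commute T (parentOp t' i')) (Commute.one_left _)
    fun s j _ => parentOp_induction (p := fun T => Commute (ancestorOp s j) T)
      (Commute.one_right _) fun s' j' _ => commute_ancestorOp s s' j j'

theorem commute_particleOp_parentOp [SFinite μ] (t t' : Fin (n + 1)) (i : Fin (N t))
    (i' : Fin (N t')) : Commute (particleOp μ t i : Op (Aug X N C)) (parentOp t' i') :=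
  parentOp_induction (p := fun T => Commute (particleOp μ t i) T) (Commute.one_right _)
    fun s' j' _ => commute_particleOp_ancestorOp t i s' j'

theorem commute_backwardOp_parentOp {s : Fin n} {t : Fin (n + 1)} {i : Fin (N t)}
    (h : t ≤ s.castSucc → i = b t ∧ t = s.castSucc) :
    Commute (m.backwardOp b s) (parentOp t i) := by
  refine parentOp_induction (p := fun T => Commute (m.backwardOp b s) T) (Commute.one_right _)
    fun r j hj => ?_
  obtain ⟨rfl, hj⟩ := Sigma.mk.inj_iff.1 hj
  obtain rfl := eq_of_heq hj
  exact m.commute_backwardOp_ancestorOp h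

theorem commute_scale_parentOp {d : Aug X N C → ℝ≥0∞} (hd : Measurable d) {t : Fin (n + 1)}
    {i : Fin (N t)} (h : ∀ (s : Fin n) (j : Fin (N s.succ)),
      (⟨s.succ, j⟩ : Σ t, Fin (N t)) = ⟨t, i⟩ → ∀ u k, d (setA s j u k) = d u) :
    Commute (scale d hd) (parentOp t i) :=
  parentOp_induction (p := fun T => Commute (scale d hd) T) (Commute.one_right _)
    fun s j hj => commute_scale_ancestorOp hd (h s j hj)

end Commute

end Model

/-! ### Factoring the draws of one time into integration and density -/

namespace Model

variable {X Y : Type*} [MeasurableSpace X] {μ : Measure X} {n : ℕ}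
  {N : Fin (n + 1) → ℕ} {C : Fin n → ℕ} (m : Model X Y μ n N C)

open Aug Op

/-! ### Densities of the particles of one time -/

/-- The function `d` depends only on the particles of the earlier times, the particles `i ∈ I` of
time `t`, and the parents of all of these. -/
def DependsOn (t : Fin (n + 1)) (I : Set (Fin (N t))) (d : Aug X N C → ℝ≥0) : Prop :=
  ∀ u v, (∀ i ∈ I, SameParticle t i u v) → d u = d v

section DependsOn

variable {t : Fin (n + 1)} {I : Set (Fin (N t))} {d : Aug X N C → ℝ≥0} (hd : Measurable d)

theorem DependsOn.commute_particleOp [SFinite μ] (h : DependsOn t I d) {t' : Fin (n + 1)}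
    {j : Fin (N t')} (ht : t ≤ t') (hj : ∀ i ∈ I, (⟨t, i⟩ : Σ t, Fin (N t)) ≠ ⟨t', j⟩) :
    Commute (weight d hd) (particleOp μ t' j) :=
  commute_scale_particleOp _ fun u v =>
    congrArg _ (h _ _ fun i hi => sameParticle_setX ht (hj i hi) u v)

theorem DependsOn.commute_parentOp (h : DependsOn t I d) {t' : Fin (n + 1)}
    {j : Fin (N t')} (ht : t ≤ t') (hj : ∀ i ∈ I, (⟨t, i⟩ : Σ t, Fin (N t)) ≠ ⟨t', j⟩) :
    Commute (weight d hd) (parentOp t' j) :=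
  commute_scale_parentOp _ fun s k hk u v => by
    obtain ⟨rfl, hk⟩ := Sigma.mk.inj_iff.1 hk
    obtain rfl := eq_of_heq hk
    exact congrArg _ (h _ _ fun i hi => sameParticle_setA ht (hj i hi) u v)

theorem DependsOn.commute_backwardOp {b : (t : Fin (n + 1)) → Fin (N t)} (h : DependsOn t I d)
    {s : Fin n} (ht : t ≤ s.castSucc)
    (hj : ∀ i ∈ I, (⟨t, i⟩ : Σ t, Fin (N t)) ≠ ⟨s.castSucc, b s.castSucc⟩) :
    Commute (weight d hd) (m.backwardOp b s) :=
  m.commute_scale_backwardOp _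
    (fun u j v _ => congrArg _ (h _ _ fun i _ => sameParticle_setXt t i s j u v))
    (fun u v => congrArg _ (h _ _ fun i hi => sameParticle_setX ht (hj i hi) u v))

end DependsOn

theorem dependsOn_particleDensity (t : Fin (n + 1)) (i : Fin (N t)) :
    DependsOn t {i} fun u => m.particleDensity u t i :=
  fun _ _ h => m.particleDensity_congr (h i rfl)

variable (b : (t : Fin (n + 1)) → Fin (N t))

theorem dependsOn_parentDensity (t : Fin (n + 1)) :
    DependsOn t {b t} fun u => m.parentDensity b u t :=
  fun _ _ h => m.parentDensity_congr (h (b t) rfl)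

/-- The density of the draws of all particles at time `t` except particle `b t`. -/
def othersDensity (u : Aug X N C) (t : Fin (n + 1)) : ℝ≥0 :=
  ∏ i, if i ≠ b t then m.particleDensity u t i else 1

/-- Leaving out particle `b t` lets this density pass the MCMC run of its own time, which ends by
writing that particle. -/
theorem dependsOn_othersDensity (t : Fin (n + 1)) :
    DependsOn t {b t}ᶜ fun u => m.othersDensity b u t :=
  fun _ _ h => Finset.prod_congr rfl fun i _ => by
    split_ifs with hi
    · exact m.particleDensity_congr (h i hi)
    · rfl

theorem measurable_othersDensity (t : Fin (n + 1)) :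
    Measurable fun u => m.othersDensity b u t :=
  Finset.measurable_fun_prod _ fun i _ => by
    split_ifs
    · exact m.measurable_particleDensity t i
    · exact measurable_const

/-- The density of all draws at time `t`. -/
def timeDensity (u : Aug X N C) (t : Fin (n + 1)) : ℝ≥0 :=
  m.othersDensity b u t * m.parentDensity b u t

theorem dependsOn_timeDensity (t : Fin (n + 1)) :
    DependsOn t Set.univ fun u => m.timeDensity b u t :=
  fun u v h => by
    have h1 := m.dependsOn_othersDensity b t u v fun i _ => h i trivial
    have h2 := m.dependsOn_parentDensity b t u v fun i _ => h i trivial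
    simp only [timeDensity]
    exact congrArg₂ _ h1 h2

theorem measurable_timeDensity (t : Fin (n + 1)) : Measurable fun u => m.timeDensity b u t :=
  (m.measurable_othersDensity b t).mul (m.measurable_parentDensity b t)

/-! ### The algorithm with fixed backward indices -/

theorem agreeOn_ancestorOp (s : Fin n) (i : Fin (N s.succ)) :
    AgreeOn {u : Aug X N C | u.b = b} (ancestorOp s i) (ancestorOp s i) :=
  AgreeOn.assign _ _ (measurable_setA s i) (measurable_setA s i) (fun _ _ => rfl)
    (fun _ _ _ => rfl) fun _ h _ => h

theorem agreeOn_parentOp (t : Fin (n + 1)) (i : Fin (N t)) :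
    AgreeOn {u : Aug X N C | u.b = b} (parentOp t i) (parentOp t i) :=
  parentOp_induction (p := fun T => AgreeOn {u | u.b = b} T T) AgreeOn.one
    fun s j _ => agreeOn_ancestorOp b s j

theorem agreeOn_particleOp [SFinite μ] (t : Fin (n + 1)) (i : Fin (N t)) :
    AgreeOn {u : Aug X N C | u.b = b} (particleOp μ t i) (particleOp μ t i) :=
  AgreeOn.assign _ _ (measurable_setX t i) (measurable_setX t i) (fun _ _ => rfl)
    (fun _ _ _ => rfl) fun _ h _ => h

theorem agreeOn_mcmc (s : Fin n) (j j' : Fin (C s)) :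
    AgreeOn {u | u.b = b} (ofKernel (m.drawMCMC s j j')) (m.mcmcOp b s j j') :=
  AgreeOn.assign _ _ (measurable_setXt s j') (measurable_setXt s j')
    (fun u hu => by rw [mcmcKernel, Kernel.comap_apply, Kernel.comap_apply, fixB_eq hu])
    (fun _ _ _ => rfl) fun _ h _ => h

theorem agreeOn_mcmcEnd (s : Fin n) :
    AgreeOn {u | u.b = b} (ofKernel (m.drawFromMCMC s)) (m.mcmcEndOp b s) :=
  AgreeOn.assign _ _ (measurable_setX_b _) (measurable_setX _ _)
    (fun u hu => by rw [mcmcKernel, Kernel.comap_apply, Kernel.comap_apply, fixB_eq hu])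
    (fun u hu v => by rw [show u.b = b from hu]) fun _ h _ => h

theorem agreeOn_backwardRun (s : Fin n) :
    AgreeOn {u | u.b = b} ((m.backwardRun s).map ofKernel).prod (m.backwardOp b s) := by
  rw [backwardRun, List.map_append, List.prod_append, List.map_map]
  refine AgreeOn.mul (AgreeOn.list_prod fun k _ => m.agreeOn_mcmc b s _ _) ?_
  simpa using m.agreeOn_mcmcEnd b s

/-- On the fibre the stored indices may be replaced by `b`, both in the weights and in the slot
written. After that the draw has a fixed slot and its density splits off. -/
theorem agreeOn_drawParent (t : Fin (n + 1)) :
    AgreeOn {u | u.b = b} ((m.drawParent t).map ofKernel).prod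
      (parentOp t (b t) *
        weight (fun u => m.parentDensity b u t) (m.measurable_parentDensity b t)) := by
  induction t using Fin.cases with
  | zero =>
    rw [weight_one (m.measurable_parentDensity b 0) fun _ => rfl]
    exact AgreeOn.one
  | succ s =>
    have hV : Measurable (Function.uncurry fun (u : Aug X N C) i => m.V (fixB b u) s i) :=
      measurable_from_prod_countable_left fun i => (m.measurable_V s i).comp (measurable_fixB b)
    have hV' : Measurable (Function.uncurry fun (u : Aug X N C) i => m.V u s i) :=
      measurable_from_prod_countable_left fun i => m.measurable_V s i
    have h := ofKernel_assign_drawDensity Measure.count hV (measurable_setA s (b s.succ))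
      (m.measurable_parentDensity b s.succ) fun u k => by
        have hu : AgreeUpTo s.castSucc (fixB b (setA s (b s.succ) u k)) (fixB b u) :=
          agreeUpTo_setA Fin.castSucc_lt_succ (b s.succ) (fixB b u) k
        rw [parentDensity_succ, a_setA_self, m.V_congr hu rfl]
    have hlist : ((m.drawParent s.succ).map ofKernel).prod = ofKernel
        (assign (drawIndex fun u => m.V u s) (fun u => Aug.setA s (u.b s.succ) u)) :=
      List.prod_singleton
    rw [hlist]
    refine AgreeOn.trans (T' := ofKernel (assign (drawIndex fun u : Aug X N C => m.V (fixB b u) s)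
      (setA s (b s.succ)))) ?_ ?_
    · have : IsSFiniteKernel (drawIndex fun u : Aug X N C => m.V u s) :=
        isSFiniteKernel_drawDensity _ _
      have : IsSFiniteKernel (drawIndex fun u : Aug X N C => m.V (fixB b u) s) :=
        isSFiniteKernel_drawDensity _ _
      refine AgreeOn.assign _ _ (measurable_setA_b s) (measurable_setA _ _) (fun u hu => ?_)
        (fun u hu v => by rw [← show u.b = b from hu]) fun _ h _ => h
      rw [drawIndex, drawDensity, drawIndex, drawDensity,
        Kernel.withDensity_apply _ hV'.coe_nnreal_ennreal,
        Kernel.withDensity_apply _ hV.coe_nnreal_ennreal, fixB_eq hu]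
    · rw [drawIndex, h]
      exact (agreeOn_ancestorOp b s _).mul (AgreeOn.scale _ _ fun _ _ => rfl)

section SigmaFinite

variable [SigmaFinite μ]

/-- The weight of the chosen parent involves earlier times only, so it moves past the integration
over the new particle and joins the importance density. -/
theorem ofKernel_drawParticle (t : Fin (n + 1)) (i : Fin (N t)) :
    ofKernel (m.drawParticle t i) = parentOp t i * particleOp μ t i *
      weight (fun u => m.particleDensity u t i) (m.measurable_particleDensity t i) := by
  induction t using Fin.cases with
  | zero =>
    have h := ofKernel_assign_drawDensity (U := Aug X N C) μ
      (d := fun _ x' => m.M₁ (m.y 0) x') ((m.M₁_meas _).comp measurable_snd)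
      (measurable_setX 0 i) (m.measurable_particleDensity 0 i) fun u v => by
        rw [particleDensity_zero, x_setX_self]
    rw [show parentOp 0 i = (1 : Op (Aug X N C)) from rfl, one_mul]
    exact h
  | succ s =>
    have hW : Measurable (Function.uncurry fun (u : Aug X N C) k => m.W u s.castSucc k) :=
      measurable_from_prod_countable_left fun k => m.measurable_W _ k
    have h1 := ofKernel_assign_drawDensity Measure.count hW (measurable_setA s i)
      (m.measurable_W_a s i) fun u k => by
        rw [a_setA_self, m.W_congr (agreeUpTo_setA Fin.castSucc_lt_succ i u k)]
    have h2 := ofKernel_assign_drawDensity μ (m.measurable_M s i) (measurable_setX s.succ i)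
      (m.measurable_M_x s i) fun u v => by
        rw [x_setX_self, x_setX_of_ne (Fin.castSucc_lt_succ).ne]; rfl
    have hc : Commute (weight _ (m.measurable_W_a s i)) (particleOp μ s.succ i) :=
      commute_scale_particleOp _ fun u v => by
        change ((m.W (setX s.succ i u v) s.castSucc (u.a s i) : ℝ≥0) : ℝ≥0∞) = _
        rw [m.W_congr (agreeUpTo_setX Fin.castSucc_lt_succ i u v)]
    have hr : ofKernel (m.drawParticle s.succ i) = ofKernel
        (assign (drawIndex fun u => m.W u s.castSucc) (Aug.setA s i)) *
        ofKernel (assign (drawDensity μ fun u x' =>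
          m.M s (m.y s.succ) (u.x s.castSucc (u.a s i)) x') (Aug.setX s.succ i)) := by
      refine (ofKernel_run _).trans ?_
      simp
    rw [hr, drawIndex, h1, h2]
    change ancestorOp s i * weight _ _ * (particleOp μ s.succ i * weight _ _) =
      ancestorOp s i * particleOp μ s.succ i * weight _ _
    rw [mul_assoc, ← mul_assoc (weight _ _), hc.eq, mul_assoc, weight_mul_weight, mul_assoc]
    rfl

/-- Integrate over all particles at time `t` except particle `b t`, and sum over their parents. -/
def othersOp (μ : Measure X) (t : Fin (n + 1)) : Op (Aug X N C) :=
  ((List.finRange (N t)).map fun i =>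
    if i ≠ b t then parentOp t i * particleOp μ t i else 1).prod

/-- Particles of one time do not read one another, so the density of particle `i` passes the draw of
any `j ≠ i`. -/
theorem agreeOn_drawOthers (t : Fin (n + 1)) :
    AgreeOn {u | u.b = b} ((m.drawOthers t).map ofKernel).prod
      (othersOp b μ t * weight (fun u => m.othersDensity b u t) (m.measurable_othersDensity b t)) := by
  have hd (i : Fin (N t)) :
      Measurable fun u => if i ≠ b t then m.particleDensity u t i else 1 := by
    split_ifs
    · exact m.measurable_particleDensity t i
    · exact measurable_const
  have hw := prod_weight hd
  change _ = weight (fun u => m.othersDensity b u t) (m.measurable_othersDensity b t) at hw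
  have hrow (i : Fin (N t)) : (if i ≠ b t then parentOp t i * particleOp μ t i else 1) *
      weight _ (hd i) = if i ≠ b t then ofKernel (m.drawParticle t i) else 1 := by
    by_cases hi : i ≠ b t
    · rw [if_pos hi, if_pos hi, ofKernel_drawParticle]
      congr 1
      exact scale_congr _ _ fun u => congrArg _ (if_pos hi)
    · rw [if_neg hi, if_neg hi, weight_one _ fun _ => if_neg hi, one_mul]
  rw [← hw, othersOp, ← list_prod_mul, drawOthers, List.map_map]
  · refine AgreeOn.list_prod fun i _ => ?_
    rw [hrow]
    refine AgreeOn.onlyIf _ _ (fun u hu => by rw [show u.b = b from hu]) ?_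
    rw [ofKernel_drawParticle]
    exact ((agreeOn_parentOp b t i).mul (agreeOn_particleOp b t i)).mul
      (AgreeOn.scale _ _ fun _ _ => rfl)
  · refine (List.nodup_finRange _).imp fun {i j} hij => ?_
    have hne : ∀ k ∈ ({i} : Set (Fin (N t))), (⟨t, k⟩ : Σ t, Fin (N t)) ≠ ⟨t, j⟩ := by
      rintro _ rfl h
      exact hij (eq_of_heq (Sigma.mk.inj_iff.1 h).2)
    have hdep : DependsOn t {i} fun u => if i ≠ b t then m.particleDensity u t i else 1 :=
      fun u v h => by
        split_ifs
        · exact m.dependsOn_particleDensity t i u v h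
        · rfl
    by_cases hj : j ≠ b t
    · rw [if_pos hj]
      exact (hdep.commute_parentOp _ le_rfl hne).mul_right
        (hdep.commute_particleOp _ le_rfl hne)
    · rw [if_neg hj]
      exact Commute.one_right _

end SigmaFinite

end Model

theorem list_prod_map_flatMap {M ι κ : Type*} [Monoid M] (l : List ι) (f : ι → List κ)
    (g : κ → M) : ((l.flatMap f).map g).prod = (l.map fun i => ((f i).map g).prod).prod := by
  induction l with
  | nil => rfl
  | cons i l ih => simp [ih]

/-! ### Sorting the steps over all times for constant backward indices -/

namespace Model

variable {X Y : Type*} [MeasurableSpace X] {μ : Measure X} {n : ℕ}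
  {N : Fin (n + 1) → ℕ} {C : Fin n → ℕ} (m : Model X Y μ n N C)

open Aug Op

/-! ### Collecting the densities of the algorithm -/

section FixedIndices

variable (b : (t : Fin (n + 1)) → Fin (N t))

/-- Integrate over all particles at time `t` except particle `b t`, and sum over the parents of
all particles. -/
def timeOp (μ : Measure X) (t : Fin (n + 1)) : Op (Aug X N C) :=
  othersOp b μ t * parentOp t (b t)

variable {b}

theorem commute_othersOp {T : Op (Aug X N C)} {t : Fin (n + 1)}
    (h : ∀ i, i ≠ b t → Commute T (parentOp t i))
    (h' : ∀ i, i ≠ b t → Commute T (particleOp μ t i)) : Commute T (othersOp b μ t) := by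
  refine commute_list_prod fun i _ => ?_
  by_cases hi : i ≠ b t
  · rw [if_pos hi]
    exact (h i hi).mul_right (h' i hi)
  · rw [if_neg hi]
    exact Commute.one_right _

theorem commute_timeOp {T : Op (Aug X N C)} {t : Fin (n + 1)}
    (h : ∀ i, Commute T (parentOp t i))
    (h' : ∀ i, i ≠ b t → Commute T (particleOp μ t i)) : Commute T (timeOp b μ t) :=
  (commute_othersOp (fun i _ => h i) h').mul_right (h _)

variable (b)

theorem dependsOn_univ_ne {t t' : Fin (n + 1)} (h : t < t') (j : Fin (N t')) :
    ∀ i ∈ (Set.univ : Set (Fin (N t))), (⟨t, i⟩ : Σ t, Fin (N t)) ≠ ⟨t', j⟩ :=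
  fun _ _ he => h.ne (congrArg Sigma.fst he)

theorem commute_timeDensity_backwardOp {t : Fin (n + 1)} {s : Fin n} (h : t < s.castSucc) :
    Commute (weight _ (m.measurable_timeDensity b t)) (m.backwardOp b s) :=
  (m.dependsOn_timeDensity b t).commute_backwardOp m _ h.le (dependsOn_univ_ne h _)

theorem measurable_prod_timeDensity :
    Measurable fun u : Aug X N C => ∏ t, m.timeDensity b u t :=
  Finset.measurable_fun_prod _ fun t _ => m.measurable_timeDensity b t

/-- The density of the other particles passes the MCMC run and the sum over the parent of particle
`b`. That sum then passes the run, which does not see this parent. -/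
theorem gibbsStep_fixed (s : Fin n) :
    othersOp b μ s.castSucc * weight _ (m.measurable_othersDensity b s.castSucc) *
      m.backwardOp b s *
      (parentOp s.castSucc (b s.castSucc) * weight _ (m.measurable_parentDensity b s.castSucc)) =
    timeOp b μ s.castSucc * m.backwardOp b s *
      weight _ (m.measurable_timeDensity b s.castSucc) := by
  have hne : ∀ i ∈ ({b s.castSucc}ᶜ : Set _),
      (⟨s.castSucc, i⟩ : Σ t, Fin (N t)) ≠ ⟨s.castSucc, b s.castSucc⟩ :=
    fun i hi h => hi (eq_of_heq (Sigma.mk.inj_iff.1 h).2)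
  have hd := m.dependsOn_othersDensity b s.castSucc
  have h1 := hd.commute_backwardOp m (m.measurable_othersDensity b _) le_rfl hne
  have h2 := hd.commute_parentOp (m.measurable_othersDensity b _) le_rfl hne
  have h3 := m.commute_backwardOp_parentOp (s := s) (i := b s.castSucc) fun _ => ⟨rfl, rfl⟩
  have h4 : weight _ (m.measurable_othersDensity b s.castSucc) *
      weight _ (m.measurable_parentDensity b s.castSucc) =
      weight _ (m.measurable_timeDensity b s.castSucc) := weight_mul_weight _ _
  rw [timeOp, ← h4]
  simp only [mul_assoc]
  rw [← mul_assoc (m.backwardOp b s), ← mul_assoc (weight _ _), (h1.mul_right h2).eq, h3.eq]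
  simp only [mul_assoc]

variable [SigmaFinite μ]

theorem commute_othersOp_parentOp (t : Fin (n + 1)) (i : Fin (N t)) :
    Commute (othersOp b μ t : Op (Aug X N C)) (parentOp t i) :=
  (commute_othersOp (fun j _ => commute_parentOp t t i j)
    fun j _ => (commute_particleOp_parentOp t t j i).symm).symm

/-- At the final time the parent of particle `b` comes before the other particles. Its density
involves only that particle, its parent and earlier times, so it passes the remaining draws. -/
theorem lastStep_fixed :
    parentOp (Fin.last n) (b (Fin.last n)) *
        weight _ (m.measurable_parentDensity b (Fin.last n)) *
      (othersOp b μ (Fin.last n) * weight _ (m.measurable_othersDensity b (Fin.last n))) =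
    timeOp b μ (Fin.last n) * weight _ (m.measurable_timeDensity b (Fin.last n)) := by
  have hd := m.dependsOn_parentDensity b (Fin.last n)
  have hne (i) (hi : i ≠ b (Fin.last n)) : ∀ j ∈ ({b (Fin.last n)} : Set (Fin (N (Fin.last n)))),
      (⟨Fin.last n, j⟩ : Σ t, Fin (N t)) ≠ ⟨Fin.last n, i⟩ := by
    rintro _ rfl h
    exact hi (eq_of_heq (Sigma.mk.inj_iff.1 h).2).symm
  have h1 : Commute (weight _ (m.measurable_parentDensity b (Fin.last n)))
      (othersOp b μ (Fin.last n)) :=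
    commute_othersOp (fun i hi => hd.commute_parentOp _ le_rfl (hne i hi))
      fun i hi => hd.commute_particleOp _ le_rfl (hne i hi)
  have h2 := commute_othersOp_parentOp (μ := μ) (C := C) b (Fin.last n) (b (Fin.last n))
  have h4 : weight _ (m.measurable_othersDensity b (Fin.last n)) *
      weight _ (m.measurable_parentDensity b (Fin.last n)) =
      weight _ (m.measurable_timeDensity b (Fin.last n)) := weight_mul_weight _ _
  rw [timeOp, ← h4, h2.eq]
  simp only [mul_assoc]
  rw [← mul_assoc (weight _ _), h1.eq, mul_assoc,
    (commute_scale_scale (m.measurable_othersDensity b _).coe_nnreal_ennreal _).eq]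

theorem commute_timeDensity_timeOp {t t' : Fin (n + 1)} (h : t < t') :
    Commute (weight _ (m.measurable_timeDensity b t)) (timeOp b μ t') :=
  commute_timeOp
    (fun i => (m.dependsOn_timeDensity b t).commute_parentOp _ h.le (dependsOn_univ_ne h i))
    fun i _ => (m.dependsOn_timeDensity b t).commute_particleOp _ h.le (dependsOn_univ_ne h i)

theorem commute_backwardOp_timeOp {t : Fin (n + 1)} {s : Fin n} (h : s.castSucc < t) :
    Commute (m.backwardOp b s) (timeOp b μ t) :=
  commute_timeOp (fun _ => m.commute_backwardOp_parentOp fun h' => absurd h' h.not_ge)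
    fun _ hi => m.commute_backwardOp_particleOp h hi

/-- Densities of a time pass everything done later, and an MCMC run passes the plain integrations of
later times. The runs keep their mutual order, since a later run may depend on the particles
produced by an earlier one. -/
theorem gibbs_fixed :
    ((List.finRange n).map fun s : Fin n => timeOp b μ s.castSucc * m.backwardOp b s *
        weight _ (m.measurable_timeDensity b s.castSucc)).prod *
      (timeOp b μ (Fin.last n) * weight _ (m.measurable_timeDensity b (Fin.last n))) =
    ((List.finRange (n + 1)).map fun t => timeOp b μ t).prod *
      ((List.finRange n).map fun s => m.backwardOp b s).prod *
      weight _ (m.measurable_prod_timeDensity b) := by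
  have hlt : (List.finRange n).Pairwise fun r s => r < s := List.pairwise_lt_finRange n
  have hw := prod_weight fun t => m.measurable_timeDensity b t
  rw [list_prod_mul, list_prod_mul]
  · have h1 : Commute ((List.finRange n).map fun s => m.backwardOp b s).prod
        (timeOp b μ (Fin.last n)) :=
      (commute_list_prod fun s _ => (m.commute_backwardOp_timeOp b (Fin.castSucc_lt_last s)).symm).symm
    have h2 : Commute ((List.finRange n).map fun s : Fin n =>
        weight _ (m.measurable_timeDensity b s.castSucc)).prod (timeOp b μ (Fin.last n)) :=
      (commute_list_prod fun s _ =>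
        (m.commute_timeDensity_timeOp b (Fin.castSucc_lt_last s)).symm).symm
    change _ = _ * _ * weight (fun u : Aug X N C => ∏ t, m.timeDensity b u t) _
    rw [← hw]
    simp only [List.finRange_succ_last, List.map_append, List.map_map, List.prod_append,
      List.map_singleton, List.prod_singleton, Function.comp_def]
    simp only [mul_assoc]
    rw [← mul_assoc _ (timeOp b μ (Fin.last n)), h2.eq]
    simp only [mul_assoc]
    rw [← mul_assoc _ (timeOp b μ (Fin.last n)), h1.eq]
    simp only [mul_assoc]
  · exact hlt.imp fun h => m.commute_backwardOp_timeOp b (Fin.castSucc_lt_castSucc_iff.2 h)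
  · exact hlt.imp fun h =>
      (m.commute_timeDensity_timeOp b (Fin.castSucc_lt_castSucc_iff.2 h)).mul_right
        (m.commute_timeDensity_backwardOp b (Fin.castSucc_lt_castSucc_iff.2 h))

/-- Integrate over all particles `x t i` with `i ≠ b t`. -/
def particlesOp (μ : Measure X) : Op (Aug X N C) :=
  ((List.finRange (n + 1)).map fun t => ((List.finRange (N t)).map fun i =>
    if i ≠ b t then particleOp μ t i else 1).prod).prod

/-- Sum over all ancestor indices. -/
def ancestorsOp : Op (Aug X N C) :=
  ((List.finRange n).map fun s =>
    ((List.finRange (N s.succ)).map fun i => ancestorOp s i).prod).prod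

/-- Without densities only product measures remain, so sums over parents and integrals over
particles separate. The parent of particle `b t` fills the gap left in the first product. -/
theorem timeOp_eq (t : Fin (n + 1)) :
    (timeOp b μ t : Op (Aug X N C)) = ((List.finRange (N t)).map fun i => parentOp t i).prod *
      ((List.finRange (N t)).map fun i => if i ≠ b t then particleOp μ t i else 1).prod := by
  have h : (othersOp b μ t : Op (Aug X N C)) =
      ((List.finRange (N t)).map fun i => if i ≠ b t then parentOp t i else 1).prod *
      ((List.finRange (N t)).map fun i => if i ≠ b t then particleOp μ t i else 1).prod := by
    rw [← list_prod_mul, othersOp]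
    · congr 2
      funext i
      by_cases hi : i ≠ b t
      · simp only [if_pos hi]
      · simp only [if_neg hi, one_mul]
    · refine List.pairwise_of_forall fun i j => ?_
      by_cases hi : i ≠ b t
      · by_cases hj : j ≠ b t
        · rw [if_pos hi, if_pos hj]
          exact commute_particleOp_parentOp t t i j
        · rw [if_neg hj]
          exact Commute.one_right _
      · rw [if_neg hi]
        exact Commute.one_left _
  have hc : Commute (parentOp t (b t) : Op (Aug X N C)) ((List.finRange (N t)).map fun i =>
      if i ≠ b t then particleOp μ t i else 1).prod := by
    refine commute_list_prod fun i _ => ?_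
    by_cases hi : i ≠ b t
    · rw [if_pos hi]
      exact (commute_particleOp_parentOp t t i (b t)).symm
    · rw [if_neg hi]
      exact Commute.one_right _
  rw [timeOp, h, mul_assoc, ← hc.eq, ← mul_assoc,
    list_prod_ite_ne (b t) _ fun i j => commute_parentOp t t i j]

theorem prod_timeOp :
    ((List.finRange (n + 1)).map fun t => timeOp b μ t).prod =
      (ancestorsOp * particlesOp b μ : Op (Aug X N C)) := by
  simp only [timeOp_eq]
  rw [list_prod_mul, particlesOp]
  · congr 1
    -- The first time contributes a trivial factor, so the product over times becomes the product
    -- over transitions.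
    rw [List.finRange_succ, List.map_cons, List.prod_cons, List.map_map]
    have h0 : ((List.finRange (N 0)).map fun i => (parentOp 0 i : Op (Aug X N C))).prod = 1 :=
      List.prod_eq_one fun T hT => by
        obtain ⟨i, _, rfl⟩ := List.mem_map.1 hT
        rfl
    rw [h0, one_mul]
    rfl
  · refine List.pairwise_of_forall fun t t' => commute_list_prod fun i _ => Commute.symm ?_
    refine commute_list_prod fun j _ => ?_
    by_cases hj : j ≠ b t
    · rw [if_pos hj]
      exact (commute_particleOp_parentOp t t' j i).symm
    · rw [if_neg hj]
      exact Commute.one_right _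

end FixedIndices

end Model

/-! ### Moving the index draws to the front; comparing algorithm and base measure; retained
variables -/

namespace Model

variable {X Y : Type*} [MeasurableSpace X] {μ : Measure X} {n : ℕ}
  {N : Fin (n + 1) → ℕ} {C : Fin n → ℕ} (m : Model X Y μ n N C)

open Aug Op

/-! ### The draws of the backward indices come first -/

theorem ofKernel_drawB (t : Fin (n + 1)) :
    ofKernel (drawB t : Kernel (Aug X N C) (Aug X N C)) =
      indexOp t * weight (fun _ => 1 / (N t : ℝ≥0)) measurable_const :=
  ofKernel_assign_drawDensity Measure.count measurable_const (measurable_setB t)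
    measurable_const fun _ _ => rfl

theorem commute_parentOp_indexOp (t t' : Fin (n + 1)) (i : Fin (N t)) :
    Commute (parentOp t i : Op (Aug X N C)) (indexOp t') :=
  parentOp_induction (p := fun T => Commute T (indexOp t')) (Commute.one_left _) fun s j _ =>
    commute_assign_assign _ _ (measurable_setA s j) (measurable_setB t') (fun _ _ => rfl)
      (fun _ _ => rfl) fun _ _ _ => rfl

theorem commute_particleOp_indexOp [SFinite μ] (t t' : Fin (n + 1)) (i : Fin (N t)) :
    Commute (particleOp μ t i : Op (Aug X N C)) (indexOp t') :=
  commute_assign_assign _ _ (measurable_setX t i) (measurable_setB t') (fun _ _ => rfl)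
    (fun _ _ => rfl) fun _ _ _ => rfl

/-- The kernel depends on backward indices only through that of its own time and, via the retained
state, the final one. -/
theorem K_setB {r : Fin n} {s : Fin n} (h : r ≠ s) (x : X) (u : Aug X N C) (k) :
    m.K r (x, setB s.castSucc u k) = m.K r (x, u) := by
  refine m.K_cond r x _ _ ⟨?_, fun _ _ _ _ => rfl, fun _ _ _ _ => rfl, ?_⟩
  · exact b_setB_of_ne (fun h' => h (Fin.castSucc_injective _ h')) u k
  · refine congrFun (retState_congr (u := setB s.castSucc u k) (v := u) m.hC (fun _ => rfl) ?_) _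
    rw [b_setB_of_ne (Fin.castSucc_lt_last s).ne']
    rfl

theorem commute_drawMCMC_indexOp {r s : Fin n} (h : r ≠ s) (j j' : Fin (C r)) :
    Commute (ofKernel (m.drawMCMC r j j')) (indexOp s.castSucc) :=
  commute_assign_assign _ _ (measurable_setXt r j') (measurable_setB _)
    (fun u k => m.K_setB h _ u k) (fun _ _ => rfl) fun _ _ _ => rfl

theorem commute_drawFromMCMC_indexOp {r s : Fin n} (h : r ≠ s) :
    Commute (ofKernel (m.drawFromMCMC r)) (indexOp s.castSucc) :=
  commute_assign_assign _ _ (measurable_setX_b _) (measurable_setB _)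
    (fun u k => m.K_setB h _ u k) (fun _ _ => rfl) fun u v k => by
      rw [b_setB_of_ne fun h' => h (Fin.castSucc_injective _ h')]
      rfl

theorem commute_drawParent_indexOp {t : Fin (n + 1)} {s : Fin n} (h : t ≠ s.castSucc) :
    Commute ((m.drawParent t).map ofKernel).prod (indexOp s.castSucc) := by
  induction t using Fin.cases with
  | zero => exact Commute.one_left _
  | succ r =>
    have hV : Measurable (Function.uncurry fun (u : Aug X N C) i => ((m.V u r i : ℝ≥0) : ℝ≥0∞)) :=
      measurable_from_prod_countable_left fun i => (m.measurable_V r i).coe_nnreal_ennreal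
    have hlist : ((m.drawParent r.succ).map ofKernel).prod = ofKernel
        (assign (drawIndex fun u => m.V u r) (fun u => Aug.setA r (u.b r.succ) u)) :=
      List.prod_singleton
    have : IsSFiniteKernel (drawIndex fun u : Aug X N C => m.V u r) :=
      isSFiniteKernel_drawDensity _ _
    rw [hlist]
    refine commute_assign_assign _ _ (measurable_setA_b r) (measurable_setB _) (fun u k => ?_)
      (fun _ _ => rfl) fun u v k => ?_
    · have hu : m.V (setB s.castSucc u k) r = m.V u r :=
        m.V_congr ⟨fun _ _ => rfl, fun _ _ => rfl⟩ (by rw [b_setB_of_ne h]; rfl)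
      rw [drawIndex, drawDensity, Kernel.withDensity_apply _ hV, Kernel.withDensity_apply _ hV, hu]
      rfl
    · rw [b_setB_of_ne h]
      rfl

/-- The product of counting measure for all backward indices except the last one. -/
def indicesOp : Op (Aug X N C) :=
  ((List.finRange n).map fun s : Fin n => indexOp s.castSucc).prod

/-- The probability of the backward indices. -/
def indexDensity (N : Fin (n + 1) → ℕ) : ℝ≥0 := ∏ s : Fin n, 1 / (N s.castSucc : ℝ≥0)

/-! ### The base measure -/

/-- The base measure given the backward indices. -/
def baseGivenIndicesOp : Op (Aug X N C) :=
  ancestorsOp * ((baseX (N := N) (C := C) μ).map ofKernel).prod *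
    ((List.finRange n).map fun s => ((m.backwardRun s).map ofKernel).prod).prod

theorem ofKernel_base :
    ofKernel (run (baseB ++ baseA ++ baseX μ ++ (List.finRange n).flatMap m.backwardRun)) =
      indicesOp * m.baseGivenIndicesOp := by
  have hB : ((baseB : List (Kernel (Aug X N C) (Aug X N C))).map ofKernel).prod = indicesOp := by
    rw [baseB, List.map_map]; rfl
  have hA : ((baseA : List (Kernel (Aug X N C) (Aug X N C))).map ofKernel).prod = ancestorsOp := by
    rw [baseA, list_prod_map_flatMap, ancestorsOp]
    simp only [List.map_map]
    rfl
  rw [ofKernel_run, List.map_append, List.map_append, List.map_append, List.prod_append,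
    List.prod_append, List.prod_append, hB, hA, list_prod_map_flatMap, baseGivenIndicesOp]
  simp only [mul_assoc]

/-- The run spares its last state, and the particle it writes belongs to a non-final time. -/
theorem commute_ret_fixB_backwardOp {b : (t : Fin (n + 1)) → Fin (N t)} {h : Ret X N → ℝ≥0∞}
    (hh : Measurable h) (s : Fin n) :
    Commute (scale (fun u : Aug X N C => h ((fixB b u).ret m.hC))
      (hh.comp ((measurable_ret m.hC).comp (measurable_fixB b)))) (m.backwardOp b s) := by
  refine m.commute_scale_backwardOp _ (fun u j v hj => congrArg h (Prod.ext ?_ rfl))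
    fun u v => congrArg h (Prod.ext ?_ rfl)
  · refine retState_congr (u := fixB b (setXt s j u v)) (v := fixB b u) m.hC (fun r => ?_) rfl
    change (setXt s j u v).xt r _ = u.xt r _
    by_cases hr : r = s
    · subst hr
      exact xt_setXt_index_of_ne hj.symm u v
    · exact congrFun (xt_setXt_of_ne hr j u v) _
  · refine retState_congr (u := fixB b (setX s.castSucc (b s.castSucc) u v)) (v := fixB b u) m.hC
      (fun _ => rfl) ?_
    exact congrFun (x_setX_of_ne (Fin.castSucc_lt_last s).ne' _ u v) _

section SigmaFinite

variable [SigmaFinite μ]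

theorem commute_drawParticle_indexOp (t t' : Fin (n + 1)) (i : Fin (N t)) :
    Commute (ofKernel (m.drawParticle t i)) (indexOp t') := by
  rw [ofKernel_drawParticle]
  refine ((commute_parentOp_indexOp t t' i).mul_left (commute_particleOp_indexOp t t' i)).mul_left ?_
  exact commute_scale_assign _ _ (measurable_setB t') fun u k =>
    congrArg _ (m.particleDensity_congr (sameParticle_setB t i t' u k))

/-- The steps of one time after the draw of the backward index. -/
def afterIndexOp (s : Fin n) : Op (Aug X N C) :=
  ((m.drawOthers s.castSucc).map ofKernel).prod * ((m.backwardRun s).map ofKernel).prod *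
    ((m.drawParent s.castSucc).map ofKernel).prod

/-- The steps of the last time. -/
def lastOp : Op (Aug X N C) :=
  ((m.drawParent (Fin.last n)).map ofKernel).prod *
    ((m.drawOthers (Fin.last n)).map ofKernel).prod

/-- After its own index draw, a time uses no backward index other than its own and the final one. -/
theorem commute_afterIndexOp_indexOp {r s : Fin n} (h : r ≠ s) :
    Commute (m.afterIndexOp r) (indexOp s.castSucc) := by
  have h' : r.castSucc ≠ s.castSucc := fun h' => h (Fin.castSucc_injective _ h')
  refine (Commute.mul_left ?_ ?_).mul_left (m.commute_drawParent_indexOp h')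
  · rw [drawOthers, List.map_map]
    refine (commute_list_prod fun i _ => Commute.symm ?_).symm
    refine commute_onlyIf_assign _ _ _ (measurable_setB _) (fun u k => ?_)
      (m.commute_drawParticle_indexOp _ _ i)
    rw [b_setB_of_ne h']
  · rw [backwardRun, List.map_append, List.prod_append, List.map_map, List.map_singleton,
      List.prod_singleton]
    refine Commute.mul_left ?_ (m.commute_drawFromMCMC_indexOp h)
    exact (commute_list_prod fun i _ => (m.commute_drawMCMC_indexOp h _ _).symm).symm

theorem commute_scale_const_map_prod (c : ℝ≥0∞) (l : List (Kernel (Aug X N C) (Aug X N C))) :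
    Commute (scale (fun _ => c) measurable_const) (l.map ofKernel).prod :=
  commute_list_prod fun κ _ => commute_scale_const c κ

theorem commute_scale_const_afterIndexOp (c : ℝ≥0∞) (s : Fin n) :
    Commute (scale (fun _ => c) measurable_const) (m.afterIndexOp s) :=
  ((commute_scale_const_map_prod c _).mul_right (commute_scale_const_map_prod c _)).mul_right
    (commute_scale_const_map_prod c _)

theorem commute_scale_const_lastOp (c : ℝ≥0∞) :
    Commute (scale (fun _ => c) measurable_const) m.lastOp :=
  (commute_scale_const_map_prod c _).mul_right (commute_scale_const_map_prod c _)

/-- The algorithm after the draws of the backward indices. -/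
def givenIndicesOp : Op (Aug X N C) :=
  ((List.finRange n).map m.afterIndexOp).prod * m.lastOp

theorem commute_scale_const_givenIndicesOp (c : ℝ≥0∞) :
    Commute (scale (fun _ => c) measurable_const) m.givenIndicesOp :=
  (commute_list_prod fun s _ => m.commute_scale_const_afterIndexOp c s).mul_right
    (m.commute_scale_const_lastOp c)

/-- Each index draw moves forward past the steps of the earlier times, which do not read that index;
its uniform density is a constant. -/
theorem ofKernel_gibbsProgram :
    ofKernel m.gibbsProgram = indicesOp *
      weight (fun _ => indexDensity N) measurable_const * m.givenIndicesOp := by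
  have hstep (s : Fin n) : ((m.gibbsStep s).map ofKernel).prod = indexOp s.castSucc *
      weight (fun _ => 1 / (N s.castSucc : ℝ≥0)) measurable_const * m.afterIndexOp s := by
    simp only [gibbsStep, List.map_append, List.prod_append, List.map_singleton,
      List.prod_singleton, ofKernel_drawB, afterIndexOp, mul_assoc]
  have hw := prod_weight (U := Aug X N C) fun s : Fin n =>
    (measurable_const (a := 1 / (N s.castSucc : ℝ≥0)))
  rw [gibbsProgram, ofKernel_run, List.map_append, List.map_append, List.prod_append,
    List.prod_append, list_prod_map_flatMap, mul_assoc, givenIndicesOp, ← mul_assoc (_ * _)]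
  change _ = indicesOp * weight (fun _ => ∏ s : Fin n, 1 / (N s.castSucc : ℝ≥0)) _ * _ * m.lastOp
  simp only [hstep]
  rw [list_prod_mul, list_prod_mul, hw]
  · rfl
  · exact List.pairwise_of_forall fun r s => commute_scale_const _ _
  · refine (List.nodup_finRange n).imp fun {r s} hrs => ?_
    exact (m.commute_afterIndexOp_indexOp hrs).mul_right
      (m.commute_scale_const_afterIndexOp _ r).symm

variable (b : (t : Fin (n + 1)) → Fin (N t))

theorem agreeOn_baseX :
    AgreeOn {u : Aug X N C | u.b = b} ((baseX (N := N) (C := C) μ).map ofKernel).prod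
      (particlesOp b μ) := by
  rw [baseX, list_prod_map_flatMap, particlesOp]
  simp only [List.map_map]
  refine AgreeOn.list_prod fun t _ => AgreeOn.list_prod fun i _ => ?_
  exact AgreeOn.onlyIf _ _ (fun u hu => by rw [show u.b = b from hu]) (agreeOn_particleOp b t i)

theorem agreeOn_ancestorsOp :
    AgreeOn {u : Aug X N C | u.b = b} ancestorsOp ancestorsOp :=
  AgreeOn.list_prod fun s _ => AgreeOn.list_prod fun i _ => agreeOn_ancestorOp b s i

theorem agreeOn_baseGivenIndicesOp :
    AgreeOn {u | u.b = b} m.baseGivenIndicesOp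
      (((List.finRange (n + 1)).map fun t => timeOp b μ t).prod *
        ((List.finRange n).map fun s => m.backwardOp b s).prod) := by
  rw [prod_timeOp]
  exact ((agreeOn_ancestorsOp b).mul (agreeOn_baseX b)).mul
    (AgreeOn.list_prod fun s _ => m.agreeOn_backwardRun b s)

/-- Compared with `agreeOn_baseGivenIndicesOp`, the same integrations appear and the collected
density is the only extra factor. This is the change of measure behind the theorem. -/
theorem agreeOn_givenIndicesOp :
    AgreeOn {u | u.b = b} m.givenIndicesOp
      (((List.finRange (n + 1)).map fun t => timeOp b μ t).prod *
        ((List.finRange n).map fun s => m.backwardOp b s).prod *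
        weight _ (m.measurable_prod_timeDensity b)) := by
  rw [← gibbs_fixed, givenIndicesOp]
  refine AgreeOn.mul (AgreeOn.list_prod fun s _ => ?_) ?_
  · rw [← gibbsStep_fixed]
    exact ((m.agreeOn_drawOthers b _).mul (m.agreeOn_backwardRun b s)).mul
      (m.agreeOn_drawParent b _)
  · rw [← lastStep_fixed]
    exact (m.agreeOn_drawParent b _).mul (m.agreeOn_drawOthers b _)

/-! ### The retained variables are left unchanged -/

section Ret

variable {b} {h : Ret X N → ℝ≥0∞} (hh : Measurable h)

theorem commute_ret_fixB_timeOp (hC : ∀ s, 0 < C s) (t : Fin (n + 1)) :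
    Commute (scale (fun u : Aug X N C => h ((fixB b u).ret hC))
      (hh.comp ((measurable_ret hC).comp (measurable_fixB b)))) (timeOp b μ t) := by
  refine commute_timeOp (fun i => commute_scale_parentOp _ fun _ _ _ _ _ => rfl) fun i hi =>
    commute_scale_particleOp _ fun u v => congrArg h (Prod.ext ?_ rfl)
  refine retState_congr (u := fixB b (setX t i u v)) (v := fixB b u) hC (fun _ => rfl) ?_
  change (setX t i u v).x (Fin.last n) (b (Fin.last n)) = u.x (Fin.last n) (b (Fin.last n))
  by_cases ht : Fin.last n = t
  · subst ht
    exact x_setX_index_of_ne hi.symm u v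
  · exact congrFun (x_setX_of_ne ht i u v) _

theorem agreeOn_ret_fixB (hC : ∀ s, 0 < C s) :
    AgreeOn {u : Aug X N C | u.b = b} (scale (fun u => h (u.ret hC)) (hh.comp (measurable_ret hC)))
      (scale (fun u : Aug X N C => h ((fixB b u).ret hC))
        (hh.comp ((measurable_ret hC).comp (measurable_fixB b)))) :=
  AgreeOn.scale _ _ fun u hu => by rw [fixB_eq hu]

/-- On a fibre the retained particle sits in a constant slot, which no step writes; `fixB` makes
this location constant off the fibre too. -/
theorem commute_ret_givenIndicesOp :
    Commute (scale (fun u : Aug X N C => h (u.ret m.hC))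
      (hh.comp (measurable_ret m.hC))) m.givenIndicesOp := by
  refine AgreeOn.eq_of_forall (S := fun b => {u : Aug X N C | u.b = b}) (fun u => ⟨u.b, rfl⟩)
    fun b => ?_
  have h1 := m.agreeOn_givenIndicesOp b
  have h2 := agreeOn_ret_fixB (b := b) hh m.hC
  have hc : Commute (scale (fun u : Aug X N C => h ((fixB b u).ret m.hC))
      (hh.comp ((measurable_ret m.hC).comp (measurable_fixB b))))
      (((List.finRange (n + 1)).map fun t => timeOp b μ t).prod *
        ((List.finRange n).map fun s => m.backwardOp b s).prod *
        weight _ (m.measurable_prod_timeDensity b)) :=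
    ((commute_list_prod fun t _ => commute_ret_fixB_timeOp hh m.hC t).mul_right
      (commute_list_prod fun s _ => m.commute_ret_fixB_backwardOp hh s)).mul_right
      (commute_scale_scale _ _)
  refine (h2.mul h1).trans ?_
  rw [hc.eq]
  exact (h1.mul h2).symm

/-- Commutation for every `h` expresses that the retained variables have the same values before and
after the program. -/
theorem commute_ret_gibbsProgram :
    Commute (scale (fun u : Aug X N C => h (u.ret m.hC))
      (hh.comp (measurable_ret m.hC)))
      (ofKernel m.gibbsProgram) := by
  rw [ofKernel_gibbsProgram]
  refine (Commute.mul_right ?_ (commute_scale_scale _ _)).mul_right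
    (m.commute_ret_givenIndicesOp hh)
  refine commute_list_prod fun s _ => commute_scale_assign _ _ (measurable_setB _) fun u k => ?_
  have hl : (setB s.castSucc u k).b (Fin.last n) = u.b (Fin.last n) :=
    b_setB_of_ne (Fin.castSucc_lt_last s).ne' u k
  refine congrArg h (Prod.ext ?_ hl)
  refine retState_congr (u := setB s.castSucc u k) (v := u) m.hC (fun _ => rfl) ?_
  rw [hl]
  rfl

end Ret

end SigmaFinite

end Model

/-! ### Markov kernels -/

section Markov

variable {U V : Type*} [MeasurableSpace U] [MeasurableSpace V]

theorem isMarkovKernel_assign (κ : Kernel U V) [IsMarkovKernel κ] {w : U → V → U}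
    (hw : Measurable (Function.uncurry w)) : IsMarkovKernel (assign κ w) :=
  Kernel.IsMarkovKernel.map _ hw

theorem isMarkovKernel_run {l : List (Kernel U U)} (h : ∀ κ ∈ l, IsMarkovKernel κ) :
    IsMarkovKernel (run l) := by
  suffices H : ∀ κ₀ : Kernel U U, IsMarkovKernel κ₀ →
      IsMarkovKernel (l.foldl (fun acc κ => κ ∘ₖ acc) κ₀) from H _ inferInstance
  induction l with
  | nil => exact fun _ h₀ => h₀
  | cons κ l ih =>
    intro κ₀ h₀
    have := h κ (by simp)
    exact ih (fun η hη => h η (by simp [hη])) _ inferInstance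

theorem isMarkovKernel_drawDensity (ρ : Measure V) [SFinite ρ] {d : U → V → ℝ≥0}
    (hd : Measurable (Function.uncurry d)) (h : ∀ u, ∫⁻ v, d u v ∂ρ = 1) :
    IsMarkovKernel (drawDensity ρ d) := by
  refine ⟨fun u => ⟨?_⟩⟩
  rw [drawDensity, Kernel.withDensity_apply' _ hd.coe_nnreal_ennreal, Measure.restrict_univ,
    Kernel.const_apply]
  exact h u

theorem isMarkovKernel_drawIndex {m : ℕ} {p : U → Fin m → ℝ≥0} (hp : ∀ i, Measurable fun u => p u i)
    (h : ∀ u, ∑ i, p u i = 1) : IsMarkovKernel (drawIndex p) := by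
  refine isMarkovKernel_drawDensity _ (measurable_from_prod_countable_left hp) fun u => ?_
  rw [lintegral_count, tsum_fintype, ← ENNReal.ofNNReal_finsetSum, h, ENNReal.coe_one]

theorem isMarkovKernel_onlyIf (P : U → Prop) (hP : MeasurableSet {u | P u}) (κ : Kernel U U)
    [IsMarkovKernel κ] : IsMarkovKernel (onlyIf P hP κ) := by
  unfold onlyIf
  infer_instance

end Markov

/-! ### Total mass of the algorithm, factorization of the target density, and disintegration -/

namespace Model

variable {X Y : Type*} [MeasurableSpace X] {μ : Measure X} {n : ℕ}
  {N : Fin (n + 1) → ℕ} {C : Fin n → ℕ} (m : Model X Y μ n N C)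

open Aug Op

theorem isMarkovKernel_backwardRun (s : Fin n) :
    ∀ κ ∈ m.backwardRun s, IsMarkovKernel κ := by
  intro κ hκ
  rw [backwardRun, List.mem_append, List.mem_map, List.mem_singleton] at hκ
  rcases hκ with ⟨k, _, rfl⟩ | rfl
  · exact isMarkovKernel_assign _ (measurable_setXt _ _)
  · exact isMarkovKernel_assign _ (measurable_setX_b _)

theorem isMarkovKernel_drawParent (t : Fin (n + 1)) :
    ∀ κ ∈ m.drawParent t, IsMarkovKernel κ := by
  induction t using Fin.cases with
  | zero => intro κ hκ; cases hκ
  | succ s =>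
    intro κ hκ
    obtain rfl := List.mem_singleton.1 hκ
    have := isMarkovKernel_drawIndex (p := fun u : Aug X N C => m.V u s)
      (m.measurable_V s) fun u => m.sum_V u s
    exact isMarkovKernel_assign _ (measurable_setA_b s)

theorem isMarkovKernel_drawB {t : Fin (n + 1)} (ht : 0 < N t) :
    IsMarkovKernel (drawB t : Kernel (Aug X N C) (Aug X N C)) := by
  have := isMarkovKernel_drawIndex (U := Aug X N C) (m := N t) (p := fun _ _ => 1 / (N t : ℝ≥0))
    (fun _ => measurable_const) fun u => by
      have : (N t : ℝ≥0) ≠ 0 := by exact_mod_cast ht.ne'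
      simp [this]
  exact isMarkovKernel_assign _ (measurable_setB t)

section SigmaFinite

variable [SigmaFinite μ]

theorem isMarkovKernel_drawParticle (t : Fin (n + 1)) (i : Fin (N t)) :
    IsMarkovKernel (m.drawParticle t i) := by
  induction t using Fin.cases with
  | zero =>
    have := isMarkovKernel_drawDensity (U := Aug X N C) μ (d := fun _ x' => m.M₁ (m.y 0) x')
      ((m.M₁_meas _).comp measurable_snd) fun _ => m.M₁_int _
    exact isMarkovKernel_assign _ (measurable_setX 0 i)
  | succ s =>
    have h1 := isMarkovKernel_drawIndex (p := fun u : Aug X N C => m.W u s.castSucc)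
      (m.measurable_W _) fun u => m.sum_W u _
    have h2 := isMarkovKernel_drawDensity μ (m.measurable_M (C := C) s i) fun _ => m.M_int _ _ _
    refine isMarkovKernel_run fun κ hκ => ?_
    rw [List.mem_cons, List.mem_singleton] at hκ
    rcases hκ with rfl | rfl
    · exact isMarkovKernel_assign _ (measurable_setA s i)
    · exact isMarkovKernel_assign _ (measurable_setX s.succ i)

theorem isMarkovKernel_drawOthers (t : Fin (n + 1)) :
    ∀ κ ∈ m.drawOthers t, IsMarkovKernel κ := by
  intro κ hκ
  obtain ⟨i, _, rfl⟩ := List.mem_map.1 hκ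
  have := m.isMarkovKernel_drawParticle t i
  exact isMarkovKernel_onlyIf _ _ _

instance isMarkovKernel_gibbsProgram : IsMarkovKernel m.gibbsProgram := by
  refine isMarkovKernel_run fun κ hκ => ?_
  rw [List.mem_append, List.mem_append, List.mem_flatMap] at hκ
  rcases hκ with (⟨s, _, hκ⟩ | hκ) | hκ
  · rw [gibbsStep, List.mem_append, List.mem_append, List.mem_append, List.mem_singleton] at hκ
    rcases hκ with ((rfl | hκ) | hκ) | hκ
    · exact isMarkovKernel_drawB (m.hN _)
    · exact m.isMarkovKernel_drawOthers _ κ hκ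
    · exact m.isMarkovKernel_backwardRun s κ hκ
    · exact m.isMarkovKernel_drawParent _ κ hκ
  · exact m.isMarkovKernel_drawParent _ κ hκ
  · exact m.isMarkovKernel_drawOthers _ κ hκ

instance isMarkovKernel_gibbs : IsMarkovKernel m.gibbs := by
  unfold gibbs
  infer_instance

end SigmaFinite

/-! ### The target density -/

theorem particleDensity_prod (u : Aug X N C) :
    m.smcDensity u = ∏ t, ∏ i, m.particleDensity u t i := by
  rw [smcDensity, Fin.prod_univ_succ]
  simp only [particleDensity_succ, particleDensity_zero, Finset.prod_mul_distrib]

theorem particleDensity_prod_b (u : Aug X N C) :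
    m.smcDensityB u = ∏ t, m.particleDensity u t (u.b t) := by
  rw [smcDensityB, Fin.prod_univ_succ]
  simp only [particleDensity_succ, particleDensity_zero]

theorem othersDensity_mul (b : (t : Fin (n + 1)) → Fin (N t)) (u : Aug X N C) (t : Fin (n + 1)) :
    m.othersDensity b u t * m.particleDensity u t (b t) = ∏ i, m.particleDensity u t i := by
  have h : m.particleDensity u t (b t) =
      ∏ i, if i ≠ b t then 1 else m.particleDensity u t i := by
    simp [ite_not]
  rw [h, othersDensity, ← Finset.prod_mul_distrib]
  refine Finset.prod_congr rfl fun i _ => ?_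
  split_ifs <;> simp

theorem ancestorFactor_eq (u : Aug X N C) :
    m.ancestorFactor u = ∏ t, m.parentDensity u.b u t := by
  rw [Fin.prod_univ_succ, show m.parentDensity u.b u 0 = 1 from rfl, one_mul]
  rfl

/-- All particle densities are positive, so dividing by the factors of the particles `b t` is a
genuine cancellation and leaves the other particles. -/
theorem prod_timeDensity_eq (u : Aug X N C) :
    ∏ t, m.timeDensity u.b u t = m.smcDensity u / m.smcDensityB u * m.ancestorFactor u := by
  have hB : m.smcDensityB u ≠ 0 := by
    rw [particleDensity_prod_b]
    exact Finset.prod_ne_zero_iff.2 fun t _ => (m.particleDensity_pos u t _).ne'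
  have h : m.smcDensity u = (∏ t, m.othersDensity u.b u t) * m.smcDensityB u := by
    rw [particleDensity_prod, particleDensity_prod_b, ← Finset.prod_mul_distrib]
    exact Finset.prod_congr rfl fun t _ => (m.othersDensity_mul u.b u t).symm
  rw [h, mul_div_cancel_right₀ _ hB, ancestorFactor_eq, ← Finset.prod_mul_distrib]
  rfl

/-- The density of the retained variables under the target distribution. -/
def retDensity (r : Ret X N) : ℝ≥0∞ :=
  m.posterior r.1 * (1 / (N (Fin.last n) : ℝ≥0) : ℝ≥0)

/-- Splits Π into what the draws given the indices contribute, the law of the retained variables,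
and the uniform law of the drawn indices. -/
theorem targetDensity_eq (u : Aug X N C) :
    m.targetDensity u = ((∏ t, m.timeDensity u.b u t : ℝ≥0) : ℝ≥0∞) *
      (m.retDensity (u.ret m.hC) * (indexDensity N : ℝ≥0∞)) := by
  rw [prod_timeDensity_eq, targetDensity, ENNReal.coe_mul, retDensity, indexDensity]
  change _ = _ * (m.posterior (u.retState m.hC) * _ * _)
  ring

theorem measurable_joint : Measurable m.joint := by
  refine (((m.g_meas _ _).comp (measurable_pi_apply _)).mul
    (m.f₁_meas.comp (measurable_pi_apply _))).mul (Finset.measurable_fun_prod _ fun s _ => ?_)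
  have hz : Measurable fun z : Fin (n + 1) → X => (z s.castSucc, z s.succ) :=
    (measurable_pi_apply _).prodMk (measurable_pi_apply _)
  exact ((m.g_meas _ _).comp (measurable_pi_apply _)).mul ((m.f_meas s).comp hz)

theorem measurable_posterior : Measurable m.posterior :=
  m.measurable_joint.coe_nnreal_ennreal.div_const _

theorem measurable_retDensity : Measurable m.retDensity :=
  (m.measurable_posterior.comp measurable_fst).mul_const _

theorem measurable_targetDensity : Measurable m.targetDensity := by
  rw [funext m.targetDensity_eq]
  refine Measurable.mul (Measurable.coe_nnreal_ennreal ?_)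
    ((m.measurable_retDensity.comp (measurable_ret m.hC)).mul_const _)
  -- The whole vector of backward indices serves as the countable index.
  exact measurable_apply_index (f := fun b (u : Aug X N C) => ∏ t, m.timeDensity b u t)
    (fun b => m.measurable_prod_timeDensity b) measurable_b

theorem joint_pos (z : Fin (n + 1) → X) : 0 < m.joint z :=
  mul_pos (mul_pos (m.g_pos _ _ _) (m.f₁_pos _))
    (Finset.prod_pos fun _ _ => mul_pos (m.g_pos _ _ _) (m.f_pos _ _ _))

section Target

variable [SigmaFinite μ]

/-- The joint density is positive everywhere, and μ is nonzero because it carries a probability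
density; hence the product measure is nonzero too. -/
theorem evidence_ne_zero : m.evidence ≠ 0 := by
  have hμ : μ ≠ 0 := by
    rintro rfl
    simpa using m.f₁_int
  intro h
  rw [evidence, lintegral_eq_zero_iff m.measurable_joint.coe_nnreal_ennreal] at h
  have huniv : (Measure.pi fun _ : Fin (n + 1) => μ) Set.univ = 0 :=
    measure_mono_null (fun z _ => by
      simpa using (m.joint_pos z).ne') (ae_iff.1 h)
  rw [Measure.pi_univ, Finset.prod_eq_zero_iff] at huniv
  obtain ⟨_, _, h0⟩ := huniv
  exact hμ (Measure.measure_univ_eq_zero.1 h0)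

/-- The reference measure for the retained variables. -/
def retBase (N : Fin (n + 1) → ℕ) (μ : Measure X) [SigmaFinite μ] : Measure (Ret X N) :=
  (Measure.pi fun _ : Fin (n + 1) => μ).prod Measure.count

theorem isProbabilityMeasure_ret (hy : m.evidence ≠ ⊤) :
    IsProbabilityMeasure ((retBase N μ).withDensity m.retDensity) := by
  refine ⟨?_⟩
  have hN : (N (Fin.last n) : ℝ≥0) ≠ 0 := by exact_mod_cast (m.hN _).ne'
  have h := lintegral_prod_mul (μ := Measure.pi fun _ : Fin (n + 1) => μ)
    (ν := (Measure.count : Measure (Fin (N (Fin.last n))))) (f := m.posterior)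
    (g := fun _ => ((1 / (N (Fin.last n) : ℝ≥0) : ℝ≥0) : ℝ≥0∞))
    m.measurable_posterior.aemeasurable aemeasurable_const
  have hpost : ∫⁻ z, m.posterior z ∂(Measure.pi fun _ : Fin (n + 1) => μ) = 1 := by
    simp only [posterior, div_eq_mul_inv]
    rw [lintegral_mul_const _ m.measurable_joint.coe_nnreal_ennreal]
    exact ENNReal.mul_inv_cancel m.evidence_ne_zero hy
  have hcount : ∫⁻ _ : Fin (N (Fin.last n)), ((1 / (N (Fin.last n) : ℝ≥0) : ℝ≥0) : ℝ≥0∞)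
      ∂Measure.count = 1 := by
    rw [lintegral_count, tsum_fintype, ← ENNReal.ofNNReal_finsetSum]
    simp [hN]
  rw [withDensity_apply _ MeasurableSet.univ, Measure.restrict_univ]
  refine h.trans ?_
  rw [hpost, hcount, one_mul]

/-! ### The algorithm samples from the conditional distribution -/

/-- After the common sum over indices, both sides are compared fibre by fibre in `b` (`key`). The
density of the retained variables is then carried through the whole algorithm, which preserves them.
-/
theorem base_mul_targetDensity :
    ofKernel (run (baseB ++ baseA ++ baseX μ ++ (List.finRange n).flatMap m.backwardRun)) *
        scale m.targetDensity m.measurable_targetDensity =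
      scale (fun u : Aug X N C => m.retDensity (u.ret m.hC))
        (m.measurable_retDensity.comp (measurable_ret m.hC)) * ofKernel m.gibbsProgram := by
  have hr : Measurable fun u : Aug X N C => m.retDensity (u.ret m.hC) :=
    m.measurable_retDensity.comp (measurable_ret m.hC)
  have hc : Commute (weight (fun _ : Aug X N C => indexDensity N) measurable_const)
      m.givenIndicesOp := m.commute_scale_const_givenIndicesOp _
  have key : m.baseGivenIndicesOp * scale m.targetDensity m.measurable_targetDensity =
      m.givenIndicesOp * (scale (fun u : Aug X N C => m.retDensity (u.ret m.hC)) hr *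
        weight (fun _ => indexDensity N) measurable_const) := by
    refine AgreeOn.eq_of_forall (S := fun b => {u : Aug X N C | u.b = b}) (fun u => ⟨u.b, rfl⟩)
      fun b => ?_
    have hd : AgreeOn {u : Aug X N C | u.b = b}
        (scale m.targetDensity m.measurable_targetDensity)
        (weight _ (m.measurable_prod_timeDensity b) *
          (scale (fun u : Aug X N C => m.retDensity (u.ret m.hC)) hr *
            weight (fun _ => indexDensity N) measurable_const)) := by
      rw [scale_mul_scale, scale_mul_scale]
      exact AgreeOn.scale _ _ fun u hu => by
        rw [targetDensity_eq, show u.b = b from hu]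
    refine ((m.agreeOn_baseGivenIndicesOp b).mul hd).trans ?_
    rw [← mul_assoc]
    refine AgreeOn.mul (m.agreeOn_givenIndicesOp b).symm ?_
    rw [scale_mul_scale]
    exact AgreeOn.scale _ _ fun _ _ => rfl
  rw [(m.commute_ret_gibbsProgram m.measurable_retDensity).eq, ofKernel_base, mul_assoc, key,
    ofKernel_gibbsProgram, (commute_scale_scale hr _).eq, ← mul_assoc m.givenIndicesOp, ← hc.eq]
  simp only [mul_assoc]

theorem lintegral_gibbs {F : Aug X N C → ℝ≥0∞} (hF : Measurable F) (r : Ret X N) :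
    ∫⁻ u, F u ∂m.gibbs r = (ofKernel m.gibbsProgram ⟨F, hF⟩).1 (init m.hN r) := by
  rw [gibbs, Kernel.lintegral_comp _ _ _ hF, Kernel.lintegral_deterministic'  _ hF.lintegral_kernel]
  rfl

/-- Taking out what is known: the commutation evaluated at the initial memory, whose retained part
is `r`. -/
theorem lintegral_gibbs_ret {h : Ret X N → ℝ≥0∞} (hh : Measurable h) {F : Aug X N C → ℝ≥0∞}
    (hF : Measurable F) (r : Ret X N) :
    ∫⁻ u, h (u.ret m.hC) * F u ∂m.gibbs r = h r * ∫⁻ u, F u ∂m.gibbs r := by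
  have hc := congrFun (congrArg Subtype.val
    (congrFun (m.commute_ret_gibbsProgram hh).eq ⟨F, hF⟩)) (init m.hN r)
  have hF' : Measurable fun u : Aug X N C => h (u.ret m.hC) * F u :=
    (hh.comp (measurable_ret m.hC)).mul hF
  rw [lintegral_gibbs m hF', lintegral_gibbs m hF]
  refine hc.symm.trans ?_
  rw [mul_apply, scale_apply, ret_init]

/-- Both integrals run over the same reference measure of the retained variables, and the integrands
agree by the operator identity at the initial memory. -/
theorem target_eq :
    m.target = ((retBase N μ).withDensity m.retDensity).bind m.gibbs := by
  refine Measure.ext_of_lintegral _ fun F hF => ?_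
  rw [Measure.lintegral_bind m.gibbs.aemeasurable hF.aemeasurable,
    lintegral_withDensity_eq_lintegral_mul _ m.measurable_retDensity hF.lintegral_kernel,
    target, lintegral_withDensity_eq_lintegral_mul _ m.measurable_targetDensity hF, base,
    Measure.lintegral_bind (Kernel.aemeasurable _) (m.measurable_targetDensity.mul hF).aemeasurable]
  refine lintegral_congr fun r => ?_
  have hm := congrFun (congrArg Subtype.val
    (congrFun m.base_mul_targetDensity ⟨F, hF⟩)) (init m.hN r)
  rw [Kernel.lintegral_comp _ _ _ (m.measurable_targetDensity.mul hF),
    Kernel.lintegral_deterministic' _ (m.measurable_targetDensity.mul hF).lintegral_kernel]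
  refine Eq.trans hm ?_
  rw [mul_apply, scale_apply, ret_init, Pi.mul_apply, lintegral_gibbs m hF]

theorem isProbabilityMeasure_target (hy : m.evidence ≠ ⊤) : IsProbabilityMeasure m.target := by
  have := m.isProbabilityMeasure_ret hy
  rw [target_eq]
  infer_instance

theorem gibbs_map_ret (r : Ret X N) :
    (m.gibbs r).map (fun u => u.ret m.hC) = Measure.dirac r := by
  ext s hs
  have h1 : Measurable (s.indicator (1 : Ret X N → ℝ≥0∞)) := measurable_one.indicator hs
  have h := m.lintegral_gibbs_ret (C := C) h1 measurable_one r
  rw [Measure.map_apply (measurable_ret m.hC) hs, Measure.dirac_apply' _ hs,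
    ← lintegral_indicator_one (measurable_ret m.hC hs)]
  simpa [← Set.indicator_comp_right] using h

/-- Finite measures are determined by rectangles, and on a rectangle the indicator of the retained
variables comes out of the integral over the algorithm. -/
theorem target_map_ret (hy : m.evidence ≠ ⊤) :
    m.target.map (fun u => (u.ret m.hC, u)) =
      ((retBase N μ).withDensity m.retDensity) ⊗ₘ m.gibbs := by
  have := m.isProbabilityMeasure_ret hy
  have := m.isProbabilityMeasure_target hy
  have hpair : Measurable fun u : Aug X N C => (u.ret m.hC, u) :=
    (measurable_ret m.hC).prodMk measurable_id
  have : IsProbabilityMeasure (m.target.map fun u => (u.ret m.hC, u)) :=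
    Measure.isProbabilityMeasure_map hpair.aemeasurable
  refine Measure.ext_prod fun {s t} hs ht => ?_
  have h1 : Measurable (s.indicator (1 : Ret X N → ℝ≥0∞)) := measurable_one.indicator hs
  have h2 : Measurable (t.indicator (1 : Aug X N C → ℝ≥0∞)) := measurable_one.indicator ht
  rw [Measure.map_apply hpair (hs.prod ht), Measure.compProd_apply_prod hs ht, target_eq,
    Measure.bind_apply (hpair (hs.prod ht)) m.gibbs.aemeasurable, ← lintegral_indicator hs]
  refine lintegral_congr fun r => ?_
  have h := m.lintegral_gibbs_ret h1 h2 r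
  rw [lintegral_indicator_one ht] at h
  rw [← lintegral_indicator_one (hpair (hs.prod ht))]
  refine Eq.trans (lintegral_congr fun u => ?_) (h.trans ?_)
  · by_cases hu : u.ret m.hC ∈ s <;> by_cases hu' : u ∈ t <;> simp [hu, hu']
  · by_cases hr : r ∈ s <;> simp [hr]

end Target

end Model

end ParticleGibbs

end

theorem mainTheorem7 {X Y : Type*} [MeasurableSpace X] (μ : MeasureTheory.Measure X)
    [MeasureTheory.SigmaFinite μ] (n : ℕ) (N : Fin (n + 1) → ℕ) (C : Fin n → ℕ)
    (m : ParticleGibbs.Model X Y μ n N C) (hy : m.evidence ≠ ⊤) :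
    MeasureTheory.IsProbabilityMeasure m.target ∧
    ProbabilityTheory.IsMarkovKernel m.gibbs ∧
    (∀ r, (m.gibbs r).map (fun u => u.ret m.hC) = MeasureTheory.Measure.dirac r) ∧
    (m.target.map (fun u => (u.ret m.hC, u))).IsCondKernel m.gibbs := by
  refine ⟨m.isProbabilityMeasure_target hy, inferInstance, m.gibbs_map_ret, ⟨?_⟩⟩
  have := m.isProbabilityMeasure_ret hy
  -- The algorithm is Markov, so the first marginal of the joint law is the retained law, and the
  -- disintegration closes.
  rw [m.target_map_ret hy, Measure.fst_compProd]
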